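/- Let $p\in[1,\infty)$, let $a:[0,1]\to[0,\infty)$ be continuous, and let $g:\mathbb R\to\mathbb R$ be a nondecreasing $C^1$ function with $g(0)=0$. Let $I\subset[0,\infty)$ be a non-trivial interval containing $0$, and let $(z_0,z_1)\in\bigl(W^{2,p}(0,1)\cap W^{1,p}_0(0,1)\bigr)\times W^{1,p}_0(0,1)$. Let $z$ be a strong solution on $I$ of $$z_{tt}-z_{xx}+a(x)g(z_t)=0\ \text{ in } I\times(0,1),\qquad z(t,0)=z(t,1)=0\ \ (t\in I),\qquad z(0,\cdot)=z_0,\ z_t(0,\cdot)=z_1,$$ that is, $z\in L^\infty\bigl(I,W^{2,p}(0,1)\cap W^{1,p}_0(0,1)\bigr)\cap W^{1,\infty}\bigl(I,W^{1,p}_0(0,1)\bigr)$, $z$ is identified with its representative that is continuous on $I\times[0,1]$, the equation holds almost everywhere in $I\times(0,1)$ with weak derivatives, the boundary conditions hold for every $t\in I$, and the initial conditions hold for almost every $x\in(0,1)$ (the second with the classical one-sided time derivative at $t=0$). Then for every $t\in I$ and $x\in(0,1)$ the classical partial derivatives $z_x(t,x)$ and $z_t(t,x)$ exist ($z_t$ being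 one-sided at end points of $I$). Put $\rho=z_x+z_t$ and $\xi=z_x-z_t$. 1. For every convex function $F:\mathbb R\to\mathbb R$ of class $C^1$, the function $$\Phi(t)=\int_0^1\bigl[F(\rho(t,x))+F(\xi(t,x))\bigr]\,dx$$ is well defined on $I$ (both terms are integrable for every $t\in I$) and differentiable on $I$ (one-sidedly at end points), and for every $t\in I$ $$\Phi'(t)=-\int_0^1 a(x)\,g\Bigl(\frac{\rho-\xi}{2}\Bigr)\bigl(F'(\rho)-F'(\xi)\bigr)\,dx ,$$ where the integrand is integrable. Consequently $\Phi$ is nonincreasing on $I$. 2. In particular, the $p$-energy $E_p(t)=\frac1p\int_0^1\bigl(|z_x+z_t|^p+|z_x-z_t|^p\bigr)\,dx$ is well defined and nonincreasing on $I$. -/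

import Mathlib

open MeasureTheory Set
open scoped ENNReal NNReal ContDiff

/-- A test function on `U ⊆ ℝ`: smooth, with compact support contained in `U`. -/
def IsTestFun (U : Set ℝ) (φ : ℝ → ℝ) : Prop :=
  ContDiff ℝ ∞ φ ∧ HasCompactSupport φ ∧ tsupport φ ⊆ U

/-- Lebesgue measure on the space interval `(0,1)`. -/
noncomputable def spaceMeasure : Measure ℝ := volume.restrict (Ioo (0 : ℝ) 1)

/-- `u ∈ W^{1,p}(0,1)` with weak derivative `u'`. -/
structure IsW1 (p : ℝ) (u u' : ℝ → ℝ) : Prop where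
  memLp : MemLp u (ENNReal.ofReal p) spaceMeasure
  memLp_deriv : MemLp u' (ENNReal.ofReal p) spaceMeasure
  weakDeriv : ∀ φ : ℝ → ℝ, IsTestFun (Ioo 0 1) φ →
    ∫ x, u x * deriv φ x ∂spaceMeasure = - ∫ x, u' x * φ x ∂spaceMeasure

/-- `u ∈ W^{1,p}_0(0,1)`, the closure of `C_c^∞(0,1)` in `W^{1,p}(0,1)`, with weak derivative
`u'`. -/
structure IsW1Zero (p : ℝ) (u u' : ℝ → ℝ) : Prop extends IsW1 p u u' where
  approx : ∀ ε : ℝ≥0∞, 0 < ε → ∃ φ : ℝ → ℝ, IsTestFun (Ioo 0 1) φ ∧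
    eLpNorm (fun x => u x - φ x) (ENNReal.ofReal p) spaceMeasure
      + eLpNorm (fun x => u' x - deriv φ x) (ENNReal.ofReal p) spaceMeasure < ε

/-- `u ∈ W^{2,p}(0,1) ∩ W^{1,p}_0(0,1)` with weak derivatives `u'` and `u''`. -/
structure IsW2Zero (p : ℝ) (u u' u'' : ℝ → ℝ) : Prop where
  zero_trace : IsW1Zero p u u'
  second : IsW1 p u' u''

/-- The data space `Y_p = (W^{2,p}(0,1) ∩ W^{1,p}_0(0,1)) × W^{1,p}_0(0,1)`. -/
def MemY (p : ℝ) (z₀ z₁ : ℝ → ℝ) : Prop :=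
  (∃ u' u'' : ℝ → ℝ, IsW2Zero p z₀ u' u'') ∧ ∃ v' : ℝ → ℝ, IsW1Zero p z₁ v'

/-- Joint (a.e.) measurability on `I × (0,1)`. -/
def JointlyMeasurable (I : Set ℝ) (u : ℝ → ℝ → ℝ) : Prop :=
  AEStronglyMeasurable (fun q : ℝ × ℝ => u q.1 q.2) (volume.restrict (I ×ˢ Ioo (0 : ℝ) 1))

/-- `u ∈ L^∞(I, W^{1,p}_0(0,1))` with weak space derivative `ux`. -/
structure MemLinftyW1Zero (p : ℝ) (I : Set ℝ) (u ux : ℝ → ℝ → ℝ) : Prop where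
  meas : JointlyMeasurable I u
  meas_x : JointlyMeasurable I ux
  mem : ∀ᵐ t ∂(volume.restrict I), IsW1Zero p (u t) (ux t)
  bounded : ∃ M : ℝ≥0, ∀ᵐ t ∂(volume.restrict I),
    eLpNorm (u t) (ENNReal.ofReal p) spaceMeasure
      + eLpNorm (ux t) (ENNReal.ofReal p) spaceMeasure ≤ M

/-- `u ∈ L^∞(I, W^{2,p}(0,1) ∩ W^{1,p}_0(0,1))` with weak space derivatives `ux` and `uxx`. -/
structure MemLinftyW2Zero (p : ℝ) (I : Set ℝ) (u ux uxx : ℝ → ℝ → ℝ) : Prop where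
  meas : JointlyMeasurable I u
  meas_x : JointlyMeasurable I ux
  meas_xx : JointlyMeasurable I uxx
  mem : ∀ᵐ t ∂(volume.restrict I), IsW2Zero p (u t) (ux t) (uxx t)
  bounded : ∃ M : ℝ≥0, ∀ᵐ t ∂(volume.restrict I),
    eLpNorm (u t) (ENNReal.ofReal p) spaceMeasure
      + eLpNorm (ux t) (ENNReal.ofReal p) spaceMeasure
      + eLpNorm (uxx t) (ENNReal.ofReal p) spaceMeasure ≤ M

/-- `ut` is the weak time derivative of `u` on `I`, as functions of time with values in a space of
functions on `(0,1)`: `∫_I φ'(t) u(t) dt = - ∫_I φ(t) ut(t) dt` for every test function `φ` of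
time, an equality of (classes of) functions of `x`. -/
def HasWeakTimeDeriv (I : Set ℝ) (u ut : ℝ → ℝ → ℝ) : Prop :=
  ∀ φ : ℝ → ℝ, IsTestFun (interior I) φ →
    ∀ᵐ x ∂spaceMeasure, ∫ t in I, deriv φ t * u t x = - ∫ t in I, φ t * ut t x

/-- `z` is a strong solution on the time interval `I` of
`z_tt - z_xx + a(x) g(z_t) = 0`, `z(t,0) = 0 = z(t,1)`, `z(0,·) = z₀`, `z_t(0,·) = z₁`:
`z ∈ L^∞(I, W^{2,p} ∩ W^{1,p}_0) ∩ W^{1,∞}(I, W^{1,p}_0)`, and the equation holds almost everywhere.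
As usual, `z` denotes the representative that is continuous on `I × [0,1]`; it exists because
`W^{1,∞}(I, W^{1,p}_0(0,1))` embeds into `C(I, C[0,1])`. -/
structure IsStrongSolution (p : ℝ) (a g : ℝ → ℝ) (I : Set ℝ) (z₀ z₁ : ℝ → ℝ)
    (z : ℝ → ℝ → ℝ) : Prop where
  data : MemY p z₀ z₁
  continuousOn : ContinuousOn (fun q : ℝ × ℝ => z q.1 q.2) (I ×ˢ Icc (0 : ℝ) 1)
  equation : ∃ zx zxx zt ztx ztt : ℝ → ℝ → ℝ,
    MemLinftyW2Zero p I z zx zxx ∧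
    MemLinftyW1Zero p I zt ztx ∧
    HasWeakTimeDeriv I z zt ∧
    JointlyMeasurable I ztt ∧
    HasWeakTimeDeriv I zt ztt ∧
    ∀ᵐ q : ℝ × ℝ ∂(volume.restrict (I ×ˢ Ioo (0 : ℝ) 1)),
      ztt q.1 q.2 - zxx q.1 q.2 + a q.2 * g (zt q.1 q.2) = 0
  boundary : ∀ t ∈ I, z t 0 = 0 ∧ z t 1 = 0
  initial : ∀ᵐ x ∂spaceMeasure, z 0 x = z₀ x
  initial_velocity : ∀ᵐ x ∂spaceMeasure, HasDerivWithinAt (fun s => z s x) (z₁ x) I 0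

/-- The classical partial derivative `z_x(t,x)`. -/
noncomputable def partialX (z : ℝ → ℝ → ℝ) (t x : ℝ) : ℝ := deriv (z t) x

/-- The classical partial derivative `z_t(t,x)` (one-sided at an end point of `I` in `I`). -/
noncomputable def partialT (I : Set ℝ) (z : ℝ → ℝ → ℝ) (t x : ℝ) : ℝ :=
  derivWithin (fun s => z s x) I t

/-- The Riemann invariant `ρ = z_x + z_t`. -/
noncomputable def riemannRho (I : Set ℝ) (z : ℝ → ℝ → ℝ) (t x : ℝ) : ℝ :=
  partialX z t x + partialT I z t x

/-- The Riemann invariant `ξ = z_x - z_t`. -/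
noncomputable def riemannXi (I : Set ℝ) (z : ℝ → ℝ → ℝ) (t x : ℝ) : ℝ :=
  partialX z t x - partialT I z t x

/-- `Φ(t) = ∫₀¹ [F(ρ) + F(ξ)] dx`. -/
noncomputable def convexFunctional (F : ℝ → ℝ) (I : Set ℝ) (z : ℝ → ℝ → ℝ) (t : ℝ) : ℝ :=
  ∫ x in Ioo (0 : ℝ) 1, (F (riemannRho I z t x) + F (riemannXi I z t x))

/-- The `p`-energy `E_p(t) = (1/p) ∫₀¹ (|z_x + z_t|^p + |z_x - z_t|^p) dx`. -/
noncomputable def pEnergy (p : ℝ) (I : Set ℝ) (z : ℝ → ℝ → ℝ) (t : ℝ) : ℝ :=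
  (1 / p) * ∫ x in Ioo (0 : ℝ) 1,
    (|partialX z t x + partialT I z t x| ^ p + |partialX z t x - partialT I z t x| ^ p)

/-- The dissipation integrand `a(x) g((ρ - ξ)/2) (F'(ρ) - F'(ξ))`. -/
noncomputable def dissipation (F a g : ℝ → ℝ) (I : Set ℝ) (z : ℝ → ℝ → ℝ) (t x : ℝ) : ℝ :=
  a x * g ((riemannRho I z t x - riemannXi I z t x) / 2)
    * (deriv F (riemannRho I z t x) - deriv F (riemannXi I z t x))

/-!
# Energy estimates for the damped wave equation in one space dimension

After the odd `2`-periodic extension in space, the two Riemann invariants `ρ = z_x + z_t` and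
`ξ = z_x - z_t` become one function on a period: `ρ` at `x ∈ (0,1)` and `ξ` at `-x`. This function
satisfies the transport equation `ρ_t - ρ_x = -G`, where `G` is the extension of the damping term
`a g(z_t)`, so that along the characteristic `x = y - t` it is
`H(t,y) = A(y) - ∫₀ᵗ G(s, y - s) ds`. Since `z_t` vanishes at the end points and `g 0 = 0`, the odd
extension creates no jumps: `H` and `G` are continuous. The solution is then
`z(t,x) = ½ ∫_{t-x}^{t+x} H(t,y) dy`, and as `H` is continuously differentiable in `t`, all claims
are calculus: `Φ(t) = ∫_{-1}^{1} F(H(t,y)) dy` may be differentiated under the integral sign,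
the dissipation is nonnegative since `F'` and `g` are nondecreasing, and the `p`-energy is the limit
of the cases `F = |·|^q` as `q` decreases to `p`, which covers the nonsmooth exponent `p = 1`.
The representation is recorded in `IsCharacteristicRep`.

To obtain the representation from the weak formulation (`IsStrongSolution.exists_profile`), the
equation is tested with `sin(k π x)`. By two integrations by parts without boundary terms
(`IsW2Zero.exists_continuous_deriv`), the coefficients of `z` satisfy a forced oscillator equation
in the weak sense, and the Fourier coefficients of the invariant read along characteristics are, up
to the accumulated source, weakly constant in time (`exists_const_of_weak_oscillator`). By the du
Bois-Reymond lemma and uniqueness of Fourier coefficients of continuous functions there is a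
continuous profile `A` that does not depend on time. At first the source is known to be continuous
in space at almost every time only, because a bound in `W^{1,1}` gives no continuity in time. This
suffices for its integrals along characteristics to be jointly continuous, and these integrals
together with `A` determine `z_t`, so the source has a jointly continuous representative after all
(`exists_continuous_source`).
-/

/-! ### One-dimensional distributions -/

/-- Integration by parts for a primitive of a merely integrable function. -/
lemma integral_mul_eq_primitive_mul_sub {h ψ : ℝ → ℝ} {a b : ℝ}
    (hh : IntervalIntegrable h volume a b) (hψ : ContDiff ℝ 1 ψ) :
    ∫ x in a..b, h x * ψ x =
      (∫ x in a..b, h x) * ψ b - ∫ x in a..b, (∫ y in a..x, h y) * deriv ψ x := by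
  have hP := hh.absolutelyContinuousOnInterval_intervalIntegral (c := a) left_mem_uIcc
  have hQ : AbsolutelyContinuousOnInterval ψ a b := hψ.contDiffOn.absolutelyContinuousOnInterval
  rw [hP.integral_mul_deriv_eq_deriv_mul hQ]
  have : ∫ x in a..b, deriv (fun x => ∫ v in a..x, h v) x * ψ x = ∫ x in a..b, h x * ψ x := by
    refine intervalIntegral.integral_congr_ae ?_
    filter_upwards [hh.ae_hasDerivAt_integral] with x hx hx'
    rw [(hx (uIoc_subset_uIcc hx') a left_mem_uIcc).deriv]
  rw [this]
  simp

lemma IsTestFun.continuous {U : Set ℝ} {φ : ℝ → ℝ} (h : IsTestFun U φ) : Continuous φ :=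
  h.1.continuous

lemma IsTestFun.continuous_deriv {U : Set ℝ} {φ : ℝ → ℝ} (h : IsTestFun U φ) :
    Continuous (deriv φ) :=
  h.1.continuous_deriv (by simp)

lemma IsTestFun.integrable_mul {U : Set ℝ} {φ u : ℝ → ℝ} (h : IsTestFun U φ)
    (hu : LocallyIntegrableOn u U) : Integrable (fun x => φ x * u x) := by
  have hK : IsCompact (tsupport φ) := h.2.1
  have h1 : IntegrableOn (fun x => φ x * u x) (tsupport φ) :=
    (hu.integrableOn_compact_subset h.2.2 hK).continuousOn_mul h.continuous.continuousOn hK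
  refine (integrableOn_iff_integrable_of_support_subset ?_).1 h1
  exact (Function.support_mul_subset_left _ _).trans (subset_tsupport φ)

/-- The primitive of a test function with vanishing integral is again a test function. -/
lemma IsTestFun.exists_deriv_eq {U : Set ℝ} (hc : U.OrdConnected)
    {w : ℝ → ℝ} (hw : IsTestFun U w) (h0 : ∫ x, w x = 0) :
    ∃ φ, IsTestFun U φ ∧ deriv φ = w := by
  rcases (tsupport w).eq_empty_or_nonempty with he | hne
  · have hw0 : w = 0 := by
      rwa [tsupport_eq_empty_iff] at he
    exact ⟨0, ⟨contDiff_const, by simp [HasCompactSupport], by simp [tsupport]⟩, by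
      rw [hw0]; ext x; simp⟩
  have hK : IsCompact (tsupport w) := hw.2.1
  obtain ⟨α, hα, hαm⟩ := hK.exists_isLeast hne
  obtain ⟨β, hβ, hβm⟩ := hK.exists_isGreatest hne
  have hd : ∀ x, HasDerivAt (fun x => ∫ y in α..x, w y) (w x) x := fun x =>
    intervalIntegral.integral_hasDerivAt_right (hw.continuous.intervalIntegrable _ _)
      (hw.continuous.stronglyMeasurableAtFilter _ _) hw.continuous.continuousAt
  have hde : deriv (fun x => ∫ y in α..x, w y) = w := funext fun x => (hd x).deriv
  have hlt : ∀ x < α, w x = 0 := fun x hx => by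
    by_contra h
    exact absurd (hαm (subset_tsupport w h)) (not_le.2 hx)
  have hgt : ∀ x, β < x → w x = 0 := fun x hx => by
    by_contra h
    exact absurd (hβm (subset_tsupport w h)) (not_le.2 hx)
  have hz : ∀ x ∉ Icc α β, ∫ y in α..x, w y = 0 := by
    intro x hx
    by_cases hxα : x < α
    · rw [intervalIntegral.integral_symm, intervalIntegral.integral_of_le hxα.le,
        integral_Ioc_eq_integral_Ioo, setIntegral_eq_zero_of_forall_eq_zero, neg_zero]
      exact fun y hy => hlt y hy.2
    · have hxβ : β < x := by
        by_contra h
        exact hx ⟨not_lt.1 hxα, not_lt.1 h⟩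
      rw [intervalIntegral.integral_of_le (not_lt.1 hxα), ← integral_Icc_eq_integral_Ioc,
        setIntegral_eq_integral_of_forall_compl_eq_zero, h0]
      intro y hy
      by_contra hne
      have := subset_tsupport w hne
      exact hy ⟨hαm this, (hβm this).trans hxβ.le⟩
  have hts : tsupport (fun x => ∫ y in α..x, w y) ⊆ Icc α β := by
    refine closure_minimal ?_ isClosed_Icc
    intro x hx
    by_contra h
    exact hx (hz x h)
  refine ⟨_, ⟨?_, isCompact_Icc.of_isClosed_subset (isClosed_tsupport _) hts,
    hts.trans (hc.out (hw.2.2 hα) (hw.2.2 hβ))⟩, hde⟩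
  rw [contDiff_infty_iff_deriv]
  exact ⟨fun x => (hd x).differentiableAt, by rw [hde]; exact hw.1⟩

/-- Du Bois-Reymond: a function with vanishing weak derivative is constant. -/
lemma exists_ae_eq_const_of_integral_deriv_mul_eq_zero {J : Set ℝ} (hJ : IsOpen J)
    (hc : J.OrdConnected) {v : ℝ → ℝ} (hv : LocallyIntegrableOn v J)
    (h : ∀ φ, IsTestFun J φ → ∫ x, deriv φ x * v x = 0) :
    ∃ C : ℝ, ∀ᵐ x ∂(volume.restrict J), v x = C := by
  rcases J.eq_empty_or_nonempty with rfl | ⟨x₀, hx₀⟩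
  · exact ⟨0, by simp⟩
  obtain ⟨θ, hθ1, hθ2, hθ3, hθ4, hθ5⟩ :=
    exists_contDiff_tsupport_subset (n := ⊤) (hJ.mem_nhds hx₀)
  have hθ : IsTestFun J θ := ⟨hθ3, hθ2, hθ1⟩
  have hθi : Integrable θ := hθ.continuous.integrable_of_hasCompactSupport hθ2
  have hpos : 0 < ∫ x, θ x := by
    refine hθ.continuous.integral_pos_of_hasCompactSupport_nonneg_nonzero hθ2
      (fun x => (hθ4 (mem_range_self x)).1) (x := x₀) (by simp [hθ5])
  set I₀ := ∫ x, θ x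
  set C := (∫ x, θ x * v x) / I₀
  refine ⟨C, ?_⟩
  rw [ae_restrict_iff' hJ.measurableSet]
  have key := hJ.ae_eq_zero_of_integral_contDiff_smul_eq_zero (μ := volume)
    (f := fun x => v x - C) (hv.sub (locallyIntegrableOn_const C)) ?_
  · filter_upwards [key] with x hx hxJ
    linarith [hx hxJ]
  intro χ hχ1 hχ2 hχ3
  have hχ : IsTestFun J χ := ⟨hχ1, hχ2, hχ3⟩
  have hχi : Integrable χ := hχ.continuous.integrable_of_hasCompactSupport hχ2
  -- `χ - s θ` has integral zero, so it is the derivative of a test function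
  set s := (∫ x, χ x) / I₀
  have hw : IsTestFun J (fun x => χ x - s * θ x) := by
    refine ⟨hχ1.sub (contDiff_const.mul hθ3), hχ2.sub (hθ2.mul_left (f := fun _ => s)), ?_⟩
    refine (tsupport_sub _ _).trans (union_subset hχ3 ?_)
    exact (tsupport_mul_subset_right (f := fun _ => s) (g := θ)).trans hθ1
  obtain ⟨φ, hφ, hφd⟩ := hw.exists_deriv_eq hc (by
    rw [integral_sub hχi (hθi.const_mul s), integral_const_mul]
    simp only [s]; field_simp; ring)
  have h1 := h φ hφ
  have i1 := hχ.integrable_mul hv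
  have i2 := hθ.integrable_mul hv
  rw [hφd] at h1
  have e1 : ∫ x, (χ x - s * θ x) * v x = (∫ x, χ x * v x) - s * ∫ x, θ x * v x := by
    rw [← integral_const_mul, ← integral_sub i1 (i2.const_mul s)]
    congr 1; ext x; ring
  have e2 : ∫ x, χ x • (v x - C) = (∫ x, χ x * v x) - C * ∫ x, χ x := by
    rw [← integral_const_mul, ← integral_sub i1 (hχi.const_mul C)]
    congr 1; ext x; simp only [smul_eq_mul]; ring
  rw [e2]
  rw [e1] at h1
  have : s * ∫ x, θ x * v x = C * ∫ x, χ x := by simp only [s, C]; ring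
  linarith

/-- A function whose weak derivative on the open interval `J ⊆ [0,∞)` is `h` agrees almost
everywhere with a primitive of `h`. -/
lemma exists_ae_eq_const_add_primitive {J : Set ℝ} (hJ : IsOpen J) (hc : J.OrdConnected)
    (h0 : J ⊆ Ici 0) {u h : ℝ → ℝ} (hu : LocallyIntegrableOn u J)
    (hh : ∀ a b, IntervalIntegrable h volume a b)
    (hw : ∀ φ, IsTestFun J φ → ∫ x in J, deriv φ x * u x = - ∫ x in J, φ x * h x) :
    ∃ C : ℝ, ∀ᵐ x ∂(volume.restrict J), u x = C + ∫ y in (0 : ℝ)..x, h y := by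
  have hPc : Continuous (fun x => ∫ y in (0 : ℝ)..x, h y) :=
    intervalIntegral.continuous_primitive hh 0
  have hPl : LocallyIntegrableOn (fun x => ∫ y in (0 : ℝ)..x, h y) J :=
    hPc.locallyIntegrable.locallyIntegrableOn J
  have hsub : ∀ φ, IsTestFun J φ → ∀ f : ℝ → ℝ, ∫ x in J, φ x * f x = ∫ x, φ x * f x := by
    intro φ hφ f
    refine setIntegral_eq_integral_of_forall_compl_eq_zero fun x hx => ?_
    rw [image_eq_zero_of_notMem_tsupport (fun h' => hx (hφ.2.2 h')), zero_mul]
  have hder : ∀ φ, IsTestFun J φ → IsTestFun J (deriv φ) := fun φ hφ =>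
    ⟨(contDiff_infty_iff_deriv.1 hφ.1).2, hφ.2.1.deriv,
      (tsupport_deriv_subset (f := φ)).trans hφ.2.2⟩
  suffices key : ∀ φ, IsTestFun J φ →
      ∫ x, deriv φ x * (u x - ∫ y in (0 : ℝ)..x, h y) = 0 by
    obtain ⟨C, hC⟩ := exists_ae_eq_const_of_integral_deriv_mul_eq_zero hJ hc (hu.sub hPl) key
    refine ⟨C, ?_⟩
    filter_upwards [hC] with x hx
    simp only [Pi.sub_apply] at hx
    linarith
  intro φ hφ
  have i1 := (hder φ hφ).integrable_mul hu
  have i2 := (hder φ hφ).integrable_mul hPl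
  have e1 : ∫ x, deriv φ x * (u x - ∫ y in (0 : ℝ)..x, h y) =
      (∫ x, deriv φ x * u x) - ∫ x, deriv φ x * ∫ y in (0 : ℝ)..x, h y := by
    rw [← integral_sub i1 i2]
    congr 1; ext x; ring
  have e2 := hw φ hφ
  rw [hsub _ (hder φ hφ), hsub _ hφ] at e2
  rw [e1, e2]
  obtain ⟨b, hb⟩ : ∃ b : ℝ, ∀ x ∈ tsupport φ, x < b := by
    obtain ⟨b, hb⟩ := hφ.2.1.isCompact.bddAbove
    exact ⟨b + 1, fun x hx => (hb hx).trans_lt (lt_add_one b)⟩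
  have hb' : ∀ ζ : ℝ → ℝ, IsTestFun J ζ → tsupport ζ ⊆ tsupport φ → ∀ f : ℝ → ℝ,
      ∫ x, ζ x * f x = ∫ x in (0 : ℝ)..(max b 0), ζ x * f x := by
    intro ζ hζ hs f
    rw [intervalIntegral.integral_of_le (le_max_right _ _), ← integral_Icc_eq_integral_Ioc,
      setIntegral_eq_integral_of_forall_compl_eq_zero]
    intro x hx
    suffices hx' : x ∉ tsupport ζ by rw [image_eq_zero_of_notMem_tsupport hx', zero_mul]
    intro hx'
    exact hx ⟨h0 (hζ.2.2 hx'), (hb x (hs hx')).le.trans (le_max_left _ _)⟩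
  rw [hb' _ (hder φ hφ) tsupport_deriv_subset, hb' φ hφ subset_rfl]
  have hφb : φ (max b 0) = 0 :=
    image_eq_zero_of_notMem_tsupport fun h' => absurd (hb _ h') (not_lt.2 (le_max_left _ _))
  have := integral_mul_eq_primitive_mul_sub (hh 0 (max b 0)) (hφ.1.of_le (by simp) : ContDiff ℝ 1 φ)
  rw [hφb] at this
  simp only [mul_comm (deriv φ _), mul_comm (φ _), this]
  ring

/-! ### Sobolev functions on the unit interval -/

instance isProbabilityMeasure_spaceMeasure : IsProbabilityMeasure spaceMeasure :=
  ⟨by simp [spaceMeasure]⟩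

lemma integral_spaceMeasure (f : ℝ → ℝ) : ∫ x, f x ∂spaceMeasure = ∫ x in (0 : ℝ)..1, f x := by
  rw [spaceMeasure, intervalIntegral.integral_of_le zero_le_one, integral_Ioc_eq_integral_Ioo]

lemma integrable_spaceMeasure_iff (f : ℝ → ℝ) :
    Integrable f spaceMeasure ↔ IntervalIntegrable f volume 0 1 := by
  rw [intervalIntegrable_iff_integrableOn_Ioo_of_le zero_le_one]
  rfl

lemma ae_mem_Ioo_spaceMeasure : ∀ᵐ x ∂spaceMeasure, x ∈ Ioo (0 : ℝ) 1 :=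
  ae_restrict_mem measurableSet_Ioo

lemma one_le_ofReal {p : ℝ} (hp : 1 ≤ p) : (1 : ℝ≥0∞) ≤ ENNReal.ofReal p := by
  simpa using ENNReal.ofReal_le_ofReal hp

lemma eLpNorm_one_le {p : ℝ} (hp : 1 ≤ p) {u : ℝ → ℝ} (hu : AEStronglyMeasurable u spaceMeasure) :
    eLpNorm u 1 spaceMeasure ≤ eLpNorm u (ENNReal.ofReal p) spaceMeasure :=
  eLpNorm_le_eLpNorm_of_exponent_le (one_le_ofReal hp) hu

lemma MeasureTheory.MemLp.integrable_spaceMeasure {p : ℝ} (hp : 1 ≤ p) {u : ℝ → ℝ}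
    (hu : MemLp u (ENNReal.ofReal p) spaceMeasure) : Integrable u spaceMeasure :=
  memLp_one_iff_integrable.1 (hu.mono_exponent (one_le_ofReal hp))

lemma integral_norm_eq_eLpNorm_toReal {u : ℝ → ℝ} (hu : AEStronglyMeasurable u spaceMeasure) :
    ∫ x, ‖u x‖ ∂spaceMeasure = (eLpNorm u 1 spaceMeasure).toReal := by
  rw [eLpNorm_one_eq_lintegral_enorm, integral_norm_eq_lintegral_enorm hu]

lemma integral_norm_le_of_eLpNorm_le {p : ℝ} (hp : 1 ≤ p) {u : ℝ → ℝ}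
    (hu : AEStronglyMeasurable u spaceMeasure) {M : ℝ} (hM : 0 ≤ M)
    (h : eLpNorm u (ENNReal.ofReal p) spaceMeasure ≤ ENNReal.ofReal M) :
    ∫ x, ‖u x‖ ∂spaceMeasure ≤ M := by
  rw [integral_norm_eq_eLpNorm_toReal hu]
  exact ENNReal.toReal_le_of_le_ofReal hM ((eLpNorm_one_le hp hu).trans h)

lemma abs_primitive_le {u : ℝ → ℝ} (hu : Integrable u spaceMeasure) {x : ℝ}
    (hx : x ∈ Icc (0 : ℝ) 1) : |∫ y in (0 : ℝ)..x, u y| ≤ ∫ y, ‖u y‖ ∂spaceMeasure := by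
  have hi := (integrable_spaceMeasure_iff u).1 hu
  rw [integral_spaceMeasure]
  refine (intervalIntegral.norm_integral_le_integral_norm (f := u) (μ := volume) hx.1).trans ?_
  exact intervalIntegral.integral_mono_interval le_rfl hx.1 hx.2
    (Filter.Eventually.of_forall fun y => norm_nonneg _) hi.norm

/-- A function in `W^{1,p}_0(0,1)` is the primitive of its weak derivative that starts at `0`,
and the weak derivative has mean zero. -/
lemma IsW1Zero.ae_eq_primitive {p : ℝ} (hp : 1 ≤ p) {u u' : ℝ → ℝ} (h : IsW1Zero p u u') :
    (∀ᵐ x ∂spaceMeasure, u x = ∫ y in (0 : ℝ)..x, u' y) ∧ ∫ x, u' x ∂spaceMeasure = 0 := by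
  have hu := h.memLp.integrable_spaceMeasure hp
  have hu' := h.memLp_deriv.integrable_spaceMeasure hp
  have hi' := (integrable_spaceMeasure_iff u').1 hu'
  have hP : ContinuousOn (fun x => ∫ y in (0 : ℝ)..x, u' y) (Icc 0 1) := by
    have := intervalIntegral.continuousOn_primitive_interval' hi' left_mem_uIcc
    rwa [uIcc_of_le zero_le_one] at this
  have hPi : Integrable (fun x => ∫ y in (0 : ℝ)..x, u' y) spaceMeasure :=
    (hP.integrableOn_Icc).mono_set Ioo_subset_Icc_self
  -- test functions are primitives of their derivatives, and both sides are continuous in `W^{1,1}`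
  have key : ∀ ε : ℝ, 0 < ε → ∫ x, |u x - ∫ y in (0 : ℝ)..x, u' y| ∂spaceMeasure ≤ ε ∧
      |∫ x, u' x ∂spaceMeasure| ≤ ε := by
    intro ε hε
    obtain ⟨φ, hφ, hlt⟩ := h.approx (ENNReal.ofReal (ε / 2)) (by simpa using hε)
    have hφi : Integrable φ spaceMeasure :=
      (hφ.continuous.integrable_of_hasCompactSupport hφ.2.1).restrict
    have hφ'i : Integrable (deriv φ) spaceMeasure :=
      (hφ.continuous_deriv.integrable_of_hasCompactSupport hφ.2.1.deriv).restrict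
    have hz : ∀ x ∉ Ioo (0 : ℝ) 1, φ x = 0 := fun x hx =>
      image_eq_zero_of_notMem_tsupport fun h' => hx (hφ.2.2 h')
    have hpr : ∀ x, ∫ y in (0 : ℝ)..x, deriv φ y = φ x := fun x => by
      rw [intervalIntegral.integral_deriv_eq_sub
        (fun y _ => (hφ.1.differentiable (by simp)) y)
        (hφ.continuous_deriv.intervalIntegrable _ _), hz 0 (by simp), sub_zero]
    have hd1 : Integrable (fun x => u x - φ x) spaceMeasure := hu.sub hφi
    have hd2 : Integrable (fun x => u' x - deriv φ x) spaceMeasure := hu'.sub hφ'i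
    have b1 : ∫ x, ‖u x - φ x‖ ∂spaceMeasure ≤ ε / 2 :=
      integral_norm_le_of_eLpNorm_le hp hd1.1 (by positivity) ((le_add_right le_rfl).trans hlt.le)
    have b2 : ∫ x, ‖u' x - deriv φ x‖ ∂spaceMeasure ≤ ε / 2 :=
      integral_norm_le_of_eLpNorm_le hp hd2.1 (by positivity) ((le_add_left le_rfl).trans hlt.le)
    have hpw : ∀ x ∈ Icc (0 : ℝ) 1, |φ x - ∫ y in (0 : ℝ)..x, u' y| ≤ ε / 2 := by
      intro x hx
      have := (abs_primitive_le hd2 hx).trans b2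
      rw [intervalIntegral.integral_sub, hpr, abs_sub_comm] at this
      · exact this
      · refine hi'.mono_set ?_
        rw [uIcc_of_le hx.1, uIcc_of_le zero_le_one]
        exact Icc_subset_Icc_right hx.2
      · exact hφ.continuous_deriv.intervalIntegrable _ _
    constructor
    · calc ∫ x, |u x - ∫ y in (0 : ℝ)..x, u' y| ∂spaceMeasure
          ≤ ∫ x, (‖u x - φ x‖ + ε / 2) ∂spaceMeasure := by
            refine integral_mono_ae (hu.sub hPi).abs (hd1.norm.add (integrable_const _)) ?_
            filter_upwards [ae_mem_Ioo_spaceMeasure] with x hx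
            have h1 := hpw x (Ioo_subset_Icc_self hx)
            have h2 := abs_add_le (u x - φ x) (φ x - ∫ y in (0 : ℝ)..x, u' y)
            rw [sub_add_sub_cancel] at h2
            exact h2.trans (add_le_add le_rfl h1)
        _ ≤ ε := by
            rw [integral_add hd1.norm (integrable_const _)]
            simp only [integral_const, probReal_univ, one_smul]
            linarith
    · have := hpw 1 (by simp)
      rw [hz 1 (by simp), zero_sub, abs_neg] at this
      rw [integral_spaceMeasure]
      linarith
  have z1 : ∫ x, |u x - ∫ y in (0 : ℝ)..x, u' y| ∂spaceMeasure = 0 :=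
    le_antisymm (le_of_forall_pos_le_add fun ε hε => by simpa using (key ε hε).1)
      (integral_nonneg fun _ => abs_nonneg _)
  have z2 : |∫ x, u' x ∂spaceMeasure| = 0 :=
    le_antisymm (le_of_forall_pos_le_add fun ε hε => by simpa using (key ε hε).2) (abs_nonneg _)
  refine ⟨?_, abs_eq_zero.1 z2⟩
  have z3 := (integral_eq_zero_iff_of_nonneg (fun _ => abs_nonneg _) (hu.sub hPi).abs).1 z1
  filter_upwards [z3] with x hx
  exact sub_eq_zero.1 (abs_eq_zero.1 hx)

lemma integral_cos_mul_eq_zero {κ : ℝ} (hκ : Real.sin κ = 0) :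
    κ * ∫ x in (0 : ℝ)..1, Real.cos (κ * x) = 0 := by
  rw [intervalIntegral.mul_integral_comp_mul_left]
  simp [hκ]

/-- For `u ∈ W^{2,p} ∩ W^{1,p}_0` the weak derivative has a continuous representative, and
two integrations by parts against `sin (κ x)`, `κ ∈ π ℤ`, produce no boundary terms. -/
lemma IsW2Zero.exists_continuous_deriv {p : ℝ} (hp : 1 ≤ p) {u u' u'' : ℝ → ℝ}
    (h : IsW2Zero p u u' u'') :
    ∃ P : ℝ → ℝ, Continuous P ∧ (∀ᵐ x ∂spaceMeasure, u x = ∫ y in (0 : ℝ)..x, P y) ∧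
      ∀ κ : ℝ, Real.sin κ = 0 →
        (∫ x in (0 : ℝ)..1, P x * Real.cos (κ * x) = κ * ∫ x, u x * Real.sin (κ * x) ∂spaceMeasure)
        ∧ ∫ x, u'' x * Real.sin (κ * x) ∂spaceMeasure =
          - κ ^ 2 * ∫ x, u x * Real.sin (κ * x) ∂spaceMeasure := by
  have hu' := h.second.memLp.integrable_spaceMeasure hp
  have hu'' := h.second.memLp_deriv.integrable_spaceMeasure hp
  -- extending `u''` by zero makes its primitive continuous on the whole line
  set w : ℝ → ℝ := (Ioo (0 : ℝ) 1).indicator u''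
  have hwi : Integrable w := (integrable_indicator_iff measurableSet_Ioo).2 hu''
  have hw'' : ∀ f : ℝ → ℝ, ∫ x in Ioo (0 : ℝ) 1, f x * w x = ∫ x in Ioo (0 : ℝ) 1, f x * u'' x := by
    intro f
    refine setIntegral_congr_fun measurableSet_Ioo fun x hx => ?_
    simp only [w, indicator_of_mem hx]
  obtain ⟨C, hC⟩ := exists_ae_eq_const_add_primitive (J := Ioo (0 : ℝ) 1) isOpen_Ioo
    ordConnected_Ioo (fun x hx => hx.1.le) (u := u') (h := w) (IntegrableOn.locallyIntegrableOn hu')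
    (fun a b => hwi.intervalIntegrable) (fun φ hφ => by
      have := h.second.weakDeriv φ hφ
      rw [hw'']
      simpa only [mul_comm (deriv φ _), mul_comm (φ _), spaceMeasure] using this)
  have hPc : Continuous (fun x => C + ∫ y in (0 : ℝ)..x, w y) :=
    continuous_const.add (intervalIntegral.continuous_primitive
      (fun a b => hwi.intervalIntegrable) 0)
  obtain ⟨hprim, hmean⟩ := h.zero_trace.ae_eq_primitive hp
  have hcongr : ∀ f : ℝ → ℝ, ∫ x in (0 : ℝ)..1, u' x * f x =
      ∫ x in (0 : ℝ)..1, (C + ∫ y in (0 : ℝ)..x, w y) * f x := by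
    intro f
    rw [← integral_spaceMeasure, ← integral_spaceMeasure]
    refine integral_congr_ae ?_
    filter_upwards [hC] with x hx
    simp only [hx]
  refine ⟨_, hPc, ?_, fun κ hκ => ?_⟩
  · filter_upwards [hprim, ae_mem_Ioo_spaceMeasure] with x hx hx01
    rw [hx]
    refine intervalIntegral.integral_congr_ae_restrict ?_
    rw [uIoc_of_le hx01.1.le]
    have : (Ioc 0 x) ⊆ Ioo (0 : ℝ) 1 := fun y hy => ⟨hy.1, hy.2.trans_lt hx01.2⟩
    exact ae_restrict_of_ae_restrict_of_subset this hC
  · have hsin : ContDiff ℝ 1 (fun x => Real.sin (κ * x)) := by fun_prop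
    have hcos : ContDiff ℝ 1 (fun x => Real.cos (κ * x)) := by fun_prop
    have dsin : deriv (fun x => Real.sin (κ * x)) = fun x => κ * Real.cos (κ * x) := by
      ext x
      have : HasDerivAt (fun x : ℝ => κ * x) κ x := by simpa using (hasDerivAt_id x).const_mul κ
      rw [this.sin.deriv]; ring
    have dcos : deriv (fun x => Real.cos (κ * x)) = fun x => - (κ * Real.sin (κ * x)) := by
      ext x
      have : HasDerivAt (fun x : ℝ => κ * x) κ x := by simpa using (hasDerivAt_id x).const_mul κ
      rw [this.cos.deriv]; ring
    have e1 : ∫ x in (0 : ℝ)..1, (C + ∫ y in (0 : ℝ)..x, w y) * Real.cos (κ * x) =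
        κ * ∫ x, u x * Real.sin (κ * x) ∂spaceMeasure := by
      rw [← hcongr, integral_mul_eq_primitive_mul_sub ((integrable_spaceMeasure_iff u').1 hu') hcos,
        ← integral_spaceMeasure, hmean, dcos, zero_mul, zero_sub, ← integral_spaceMeasure,
        ← integral_const_mul, ← integral_neg]
      refine integral_congr_ae ?_
      filter_upwards [hprim] with x hx
      rw [hx]; ring
    refine ⟨e1, ?_⟩
    have e2 : ∫ x, u'' x * Real.sin (κ * x) ∂spaceMeasure =
        ∫ x in (0 : ℝ)..1, w x * Real.sin (κ * x) := by
      rw [← integral_spaceMeasure]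
      have := hw'' (fun x => Real.sin (κ * x))
      simp only [mul_comm (Real.sin _)] at this
      exact this.symm
    rw [e2, integral_mul_eq_primitive_mul_sub hwi.intervalIntegrable hsin, mul_one, hκ, mul_zero,
      zero_sub, dsin]
    have e3 : ∫ x in (0 : ℝ)..1, (C + ∫ y in (0 : ℝ)..x, w y) * Real.cos (κ * x) =
        C * (∫ x in (0 : ℝ)..1, Real.cos (κ * x)) +
          ∫ x in (0 : ℝ)..1, (∫ y in (0 : ℝ)..x, w y) * Real.cos (κ * x) := by
      rw [← intervalIntegral.integral_const_mul, ← intervalIntegral.integral_add]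
      · congr 1; ext x; ring
      · exact Continuous.intervalIntegrable (by fun_prop) _ _
      · refine Continuous.intervalIntegrable (Continuous.mul ?_ (by fun_prop)) _ _
        exact intervalIntegral.continuous_primitive (fun a b => hwi.intervalIntegrable) 0
    have e4 : ∫ x in (0 : ℝ)..1, (∫ y in (0 : ℝ)..x, w y) * (κ * Real.cos (κ * x)) =
        κ * ∫ x in (0 : ℝ)..1, (∫ y in (0 : ℝ)..x, w y) * Real.cos (κ * x) := by
      rw [← intervalIntegral.integral_const_mul]
      congr 1; ext x; ring
    rw [e4]
    have e5 := integral_cos_mul_eq_zero hκ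
    rw [e1] at e3
    linear_combination κ * e3 + C * e5

/-! ### Periodic extension and Fourier uniqueness -/

/-- The `2`-periodic triangle wave, which folds the line onto `[0,1]`: the distance of `x` to the
nearest even integer. -/
noncomputable def triangleWave (x : ℝ) : ℝ := ‖(x : AddCircle (2 : ℝ))‖

/-- The `2`-periodic odd square wave, equal to `1` on `(0,1)` and to `0` at the integers. -/
noncomputable def squareWave (x : ℝ) : ℝ := Real.sign (Real.sin (Real.pi * x))

lemma continuous_triangleWave : Continuous triangleWave :=
  continuous_norm.comp (AddCircle.continuous_mk' 2)

lemma triangleWave_neg (x : ℝ) : triangleWave (-x) = triangleWave x := by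
  simp [triangleWave]

lemma triangleWave_add_two (x : ℝ) : triangleWave (x + 2) = triangleWave x := by
  simp only [triangleWave, AddCircle.coe_add_period]

lemma triangleWave_mem (x : ℝ) : triangleWave x ∈ Icc (0 : ℝ) 1 := by
  refine ⟨norm_nonneg _, ?_⟩
  have := AddCircle.norm_le_half_period (2 : ℝ) (x := (x : AddCircle (2 : ℝ))) two_ne_zero
  simpa [triangleWave] using this

lemma triangleWave_of_mem {x : ℝ} (hx : x ∈ Icc (0 : ℝ) 1) : triangleWave x = x := by
  have := (AddCircle.norm_coe_eq_abs_iff (p := (2 : ℝ)) (x := x) two_ne_zero).2 (by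
    rw [abs_of_nonneg hx.1]; simpa using hx.2)
  rw [triangleWave, this, abs_of_nonneg hx.1]

lemma squareWave_neg (x : ℝ) : squareWave (-x) = - squareWave x := by
  simp [squareWave, Real.sign_neg]

lemma squareWave_add_two (x : ℝ) : squareWave (x + 2) = squareWave x := by
  rw [squareWave, mul_add, mul_comm Real.pi 2, Real.sin_add_two_pi, squareWave]

lemma squareWave_of_mem {x : ℝ} (hx : x ∈ Ioo (0 : ℝ) 1) : squareWave x = 1 := by
  refine Real.sign_of_pos (Real.sin_pos_of_pos_of_lt_pi (mul_pos Real.pi_pos hx.1) ?_)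
  nlinarith [Real.pi_pos, hx.2]

lemma abs_squareWave_le (x : ℝ) : |squareWave x| ≤ 1 := by
  rcases Real.sign_apply_eq (Real.sin (Real.pi * x)) with h | h | h <;> simp [squareWave, h]

lemma Real.continuous_sign_mul {X : Type*} [TopologicalSpace X] {w v : X → ℝ} (hw : Continuous w)
    (hv : Continuous v) (h : ∀ q, w q = 0 → v q = 0) :
    Continuous (fun q => Real.sign (w q) * v q) := by
  rw [continuous_iff_continuousAt]
  intro q
  rcases lt_trichotomy (w q) 0 with hq | hq | hq
  · refine (hv.neg.continuousAt).congr ?_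
    filter_upwards [hw.continuousAt.eventually_lt continuousAt_const hq] with r hr
    rw [Real.sign_of_neg hr]; simp
  · have h0 : Filter.Tendsto (fun r => |v r|) (nhds q) (nhds 0) := by
      have := hv.abs.tendsto q
      rwa [h q hq, abs_zero] at this
    unfold ContinuousAt
    simp only [hq, Real.sign_zero, zero_mul]
    refine squeeze_zero_norm (fun r => ?_) h0
    rw [norm_mul, Real.norm_eq_abs, Real.norm_eq_abs]
    refine mul_le_of_le_one_left (abs_nonneg _) ?_
    rcases Real.sign_apply_eq (w r) with h | h | h <;> simp [h]
  · refine (hv.continuousAt).congr ?_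
    filter_upwards [continuousAt_const.eventually_lt hw.continuousAt hq] with r hr
    rw [Real.sign_of_pos hr]; simp

/-- The square wave only jumps where the triangle wave takes the values `0` and `1`. -/
lemma triangleWave_eq_of_sin_eq_zero {x : ℝ} (hx : Real.sin (Real.pi * x) = 0) :
    triangleWave x = 0 ∨ triangleWave x = 1 := by
  obtain ⟨n, hn⟩ := Real.sin_eq_zero_iff.1 hx
  have hxn : x = n := by
    have := Real.pi_pos.ne'
    have h2 : Real.pi * (n : ℝ) = Real.pi * x := by linarith
    exact (mul_left_cancel₀ this h2).symm
  rcases Int.even_or_odd' n with ⟨k, hk | hk⟩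
  · left
    rw [triangleWave, norm_eq_zero, AddCircle.coe_eq_zero_iff]
    exact ⟨k, by rw [hxn, hk]; push_cast; simp [mul_comm]⟩
  · right
    have h1 : (x : AddCircle (2 : ℝ)) = ((1 : ℝ) : AddCircle (2 : ℝ)) := by
      rw [← sub_eq_zero, ← AddCircle.coe_sub, AddCircle.coe_eq_zero_iff]
      exact ⟨k, by rw [hxn, hk]; push_cast; simp [mul_comm]⟩
    rw [triangleWave, h1]
    exact triangleWave_of_mem (by simp)

lemma continuous_squareWave_mul {X : Type*} [TopologicalSpace X] {ξ v : X → ℝ}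
    (hξ : Continuous ξ) (hv : Continuous v)
    (h : ∀ q, triangleWave (ξ q) = 0 ∨ triangleWave (ξ q) = 1 → v q = 0) :
    Continuous (fun q => squareWave (ξ q) * v q) :=
  Real.continuous_sign_mul (Real.continuous_sin.comp (continuous_const.mul hξ)) hv
    fun q hq => h q (triangleWave_eq_of_sin_eq_zero hq)

/-- The `2`-periodic function whose even part is `u` and whose odd part is `v` on `(0,1)`. -/
noncomputable def periodicExt (u v : ℝ → ℝ) (x : ℝ) : ℝ :=
  u (triangleWave x) + squareWave x * v (triangleWave x)

lemma periodicExt_periodic (u v : ℝ → ℝ) : Function.Periodic (periodicExt u v) 2 := fun x => by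
  simp only [periodicExt, triangleWave_add_two, squareWave_add_two]

lemma periodicExt_of_mem (u v : ℝ → ℝ) {x : ℝ} (hx : x ∈ Ioo (0 : ℝ) 1) :
    periodicExt u v x = u x + v x := by
  rw [periodicExt, triangleWave_of_mem (Ioo_subset_Icc_self hx), squareWave_of_mem hx, one_mul]

lemma periodicExt_neg_of_mem (u v : ℝ → ℝ) {x : ℝ} (hx : x ∈ Ioo (0 : ℝ) 1) :
    periodicExt u v (-x) = u x - v x := by
  rw [periodicExt, triangleWave_neg, squareWave_neg, triangleWave_of_mem (Ioo_subset_Icc_self hx),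
    squareWave_of_mem hx]
  ring

lemma continuous_periodicExt {u v : ℝ → ℝ} (hu : Continuous u) (hv : Continuous v)
    (h0 : v 0 = 0) (h1 : v 1 = 0) : Continuous (periodicExt u v) :=
  (hu.comp continuous_triangleWave).add (continuous_squareWave_mul continuous_id
    (hv.comp continuous_triangleWave) (by rintro q (h | h) <;> simp_all))

lemma Function.Periodic.integral_neg_one_one {f : ℝ → ℝ} (hf : Function.Periodic f 2) (t : ℝ) :
    ∫ y in (-1 : ℝ)..1, f y = ∫ x in (-1 : ℝ)..1, f (x + t) := by
  rw [intervalIntegral.integral_comp_add_right]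
  have := hf.intervalIntegral_add_eq (-1) (-1 + t)
  rw [show (-1 : ℝ) + 2 = 1 by norm_num, show (-1 : ℝ) + t + 2 = 1 + t by ring] at this
  exact this

lemma integral_neg_one_one_eq {f : ℝ → ℝ} (hf : Continuous f) :
    ∫ x in (-1 : ℝ)..1, f x = ∫ x in (0 : ℝ)..1, (f x + f (-x)) := by
  have h : Continuous (fun x => f (-x)) := hf.comp continuous_neg
  rw [← intervalIntegral.integral_add_adjacent_intervals (hf.intervalIntegrable (-1) 0)
    (hf.intervalIntegrable 0 1), intervalIntegral.integral_add (hf.intervalIntegrable _ _)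
    (h.intervalIntegrable _ _), intervalIntegral.integral_comp_neg, neg_zero, add_comm]

lemma periodic_cos_int_mul_pi (k : ℤ) (θ : ℝ) :
    Function.Periodic (fun y => Real.cos (k * Real.pi * y + θ)) 2 := fun y => by
  have : (k : ℝ) * Real.pi * (y + 2) + θ = k * Real.pi * y + θ + k * (2 * Real.pi) := by ring
  simp only [this, Real.cos_add_int_mul_two_pi]

/-- Fourier coefficients of a translated periodic extension, in terms of the sine and cosine
coefficients on `(0,1)`. -/
lemma integral_periodicExt_mul_cos {u v : ℝ → ℝ} (hu : Continuous u) (hv : Continuous v)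
    (h0 : v 0 = 0) (h1 : v 1 = 0) (k : ℤ) (θ t : ℝ) :
    ∫ y in (-1 : ℝ)..1, periodicExt u v (y - t) * Real.cos (k * Real.pi * y + θ) =
      2 * Real.cos (k * Real.pi * t + θ) * (∫ x in (0 : ℝ)..1, u x * Real.cos (k * Real.pi * x))
      - 2 * Real.sin (k * Real.pi * t + θ) *
        ∫ x in (0 : ℝ)..1, v x * Real.sin (k * Real.pi * x) := by
  have hE := continuous_periodicExt hu hv h0 h1
  have hper : Function.Periodic
      (fun y => periodicExt u v (y - t) * Real.cos (k * Real.pi * y + θ)) 2 := by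
    intro y
    have e1 := periodicExt_periodic u v (y - t)
    have e2 := periodic_cos_int_mul_pi k θ y
    simp only at e2 ⊢
    rw [e2, ← e1]
    ring_nf
  rw [hper.integral_neg_one_one t]
  simp only [add_sub_cancel_right]
  rw [integral_neg_one_one_eq (by fun_prop), ← intervalIntegral.integral_const_mul,
    ← intervalIntegral.integral_const_mul, ← intervalIntegral.integral_sub
      (Continuous.intervalIntegrable (by fun_prop) _ _)
      (Continuous.intervalIntegrable (by fun_prop) _ _), ← integral_spaceMeasure,
      ← integral_spaceMeasure]
  refine integral_congr_ae ?_
  filter_upwards [ae_mem_Ioo_spaceMeasure] with x hx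
  rw [periodicExt_of_mem u v hx, periodicExt_neg_of_mem u v hx,
    show (k : ℝ) * Real.pi * (x + t) + θ = (k * Real.pi * t + θ) + k * Real.pi * x by ring,
    show (k : ℝ) * Real.pi * (-x + t) + θ = (k * Real.pi * t + θ) - k * Real.pi * x by ring,
    Real.cos_add, Real.cos_sub]
  ring

/-- A continuous `2`-periodic function all of whose Fourier coefficients vanish is zero. The phases
`0` and `π/2` give the cosine and the sine coefficients. -/
lemma Function.Periodic.eq_zero_of_integral_mul_cos_eq_zero {E : ℝ → ℝ} (hE : Continuous E)
    (hp : Function.Periodic E 2)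
    (h : ∀ (k : ℤ) (m : ℕ),
      ∫ y in (-1 : ℝ)..1, E y * Real.cos (k * Real.pi * y + m * (Real.pi / 2)) = 0) (y : ℝ) :
    E y = 0 := by
  have : Fact ((0 : ℝ) < 2) := ⟨two_pos⟩
  have hp' : Function.Periodic (fun x => (E x : ℂ)) 2 := fun x => by
    simp only [hp x]
  have hc : Continuous (hp'.lift : AddCircle (2 : ℝ) → ℂ) :=
    continuous_coinduced_dom.2 (Complex.continuous_ofReal.comp hE)
  let f : C(AddCircle (2 : ℝ), ℂ) := ⟨hp'.lift, hc⟩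
  have hcoef : ∀ n, fourierCoeff f n = 0 := by
    intro n
    rw [fourierCoeff_eq_intervalIntegral _ _ (-1)]
    have e1 : ∀ x : ℝ, (fourier (-n) (x : AddCircle (2 : ℝ)) : ℂ) • f (x : AddCircle (2 : ℝ)) =
        ((E x * Real.cos (n * Real.pi * x + (0 : ℕ) * (Real.pi / 2)) : ℝ) : ℂ) +
        ((E x * Real.cos (n * Real.pi * x + (1 : ℕ) * (Real.pi / 2)) : ℝ) : ℂ) * Complex.I := by
      intro x
      have : f (x : AddCircle (2 : ℝ)) = (E x : ℂ) := hp'.lift_coe x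
      rw [this, fourier_coe_apply]
      have e2 : 2 * (Real.pi : ℂ) * Complex.I * ((-n : ℤ) : ℂ) * (x : ℂ) / ((2 : ℝ) : ℂ) =
          ((-(n * Real.pi * x) : ℝ) : ℂ) * Complex.I := by push_cast; ring
      rw [e2, Complex.exp_mul_I, ← Complex.ofReal_cos, ← Complex.ofReal_sin, Real.cos_neg,
        Real.sin_neg]
      simp only [Nat.cast_zero, zero_mul, add_zero, Nat.cast_one, one_mul, Real.cos_add_pi_div_two]
      push_cast
      simp only [smul_eq_mul]
      ring
    have hI : ∀ m : ℕ, IntervalIntegrable (fun x : ℝ =>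
        ((E x * Real.cos (n * Real.pi * x + m * (Real.pi / 2)) : ℝ) : ℂ)) volume (-1) (-1 + 2) :=
      fun m => Continuous.intervalIntegrable (by fun_prop) _ _
    simp only [e1]
    rw [intervalIntegral.integral_add (hI 0) ((hI 1).mul_const _),
      intervalIntegral.integral_mul_const, intervalIntegral.integral_ofReal,
      intervalIntegral.integral_ofReal, show (-1 : ℝ) + 2 = 1 by norm_num, h n 0, h n 1]
    simp
  have hs : Summable (fourierCoeff f) := by
    rw [funext hcoef]; exact summable_zero
  have hy := has_pointwise_sum_fourier_series_of_summable hs (y : AddCircle (2 : ℝ))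
  simp only [hcoef, zero_smul] at hy
  have h0 := hy.unique hasSum_zero
  have h1 : f (y : AddCircle (2 : ℝ)) = (E y : ℂ) := hp'.lift_coe y
  rw [h1] at h0
  exact_mod_cast h0

/-! ### Calculus along characteristics -/

/-- Differentiation under the integral sign for integrands with a jointly continuous derivative. -/
lemma hasDerivAt_integral_of_continuous {f f' : ℝ → ℝ → ℝ} (hf : Continuous f.uncurry)
    (hf' : Continuous f'.uncurry) (hd : ∀ t y, HasDerivAt (fun s => f s y) (f' t y) t)
    (a b t : ℝ) :
    HasDerivAt (fun s => ∫ y in a..b, f s y) (∫ y in a..b, f' t y) t := by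
  obtain ⟨B, hB⟩ := ((isCompact_closedBall t 1).prod
    (isCompact_uIcc (a := a) (b := b))).exists_bound_of_continuousOn hf'.continuousOn
  refine (intervalIntegral.hasDerivAt_integral_of_dominated_loc_of_deriv_le (bound := fun _ => B)
    (Metric.closedBall_mem_nhds t one_pos) (Filter.Eventually.of_forall fun s => ?_) ?_ ?_
    (Filter.Eventually.of_forall fun y hy s hs => ?_) intervalIntegrable_const
    (Filter.Eventually.of_forall fun y hy s hs => hd s y)).2
  · exact (hf.comp (Continuous.prodMk_right s)).aestronglyMeasurable
  · exact (hf.comp (Continuous.prodMk_right t)).intervalIntegrable _ _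
  · exact (hf'.comp (Continuous.prodMk_right t)).aestronglyMeasurable
  · exact hB (s, y) ⟨hs, uIoc_subset_uIcc hy⟩

/-- Leibniz rule with a moving end point. -/
lemma hasDerivAt_integral_moving_endpoint {f f' : ℝ → ℝ → ℝ} (hf : Continuous f.uncurry)
    (hf' : Continuous f'.uncurry) (hd : ∀ t y, HasDerivAt (fun s => f s y) (f' t y) t)
    (c t : ℝ) :
    HasDerivAt (fun s => ∫ y in (0 : ℝ)..s + c, f s y)
      ((∫ y in (0 : ℝ)..t + c, f' t y) + f t (t + c)) t := by
  have h1 := hasStrictFDerivAt_uncurry_coprod (𝕜 := ℝ) (u := ((t, t + c) : ℝ × ℝ))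
    (f := fun s e => ∫ y in (0 : ℝ)..e, f s y)
    (f₁ := fun s e => ContinuousLinearMap.toSpanSingleton ℝ (∫ y in (0 : ℝ)..e, f' s y))
    (f₂ := fun s e => ContinuousLinearMap.toSpanSingleton ℝ (f s e))
    (Filter.Eventually.of_forall fun v =>
      (hasDerivAt_integral_of_continuous hf hf' hd 0 v.2 v.1).hasFDerivAt)
    (Filter.Eventually.of_forall fun v => by
      have hc : Continuous (f v.1) := hf.comp (Continuous.prodMk_right v.1)
      exact (intervalIntegral.integral_hasDerivAt_right (hc.intervalIntegrable _ _)
        (hc.stronglyMeasurableAtFilter _ _) hc.continuousAt).hasFDerivAt) ?_ ?_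
  · have h2 : HasDerivAt (fun s : ℝ => (s, s + c)) ((1 : ℝ), (1 : ℝ)) t :=
      (hasDerivAt_id t).prodMk ((hasDerivAt_id t).add_const c)
    have h3 := h1.hasFDerivAt.comp_hasDerivAt t h2
    refine h3.congr_deriv ?_
    simp [Function.HasUncurry.uncurry]
  · refine Continuous.continuousAt ?_
    have : Continuous (fun q : ℝ × ℝ => ∫ y in (0 : ℝ)..q.2, f' q.1 y) :=
      intervalIntegral.continuous_parametric_intervalIntegral_of_continuous
        (f := fun (q : ℝ × ℝ) y => f' q.1 y)
        (hf'.comp ((continuous_fst.comp continuous_fst).prodMk continuous_snd)) continuous_snd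
    exact (ContinuousLinearMap.toSpanSingletonCLE (𝕜 := ℝ) (E := ℝ)).continuous.comp this
  · exact ((ContinuousLinearMap.toSpanSingletonCLE (𝕜 := ℝ)
      (E := ℝ)).continuous.comp hf).continuousAt

lemma integral_neg_self_of_odd {G : ℝ → ℝ} (hodd : ∀ x, G (-x) = - G x) (x : ℝ) :
    ∫ y in (-x)..x, G y = 0 := by
  have h := intervalIntegral.integral_comp_neg (f := G) (a := -x) (b := x)
  simp only [hodd, neg_neg, intervalIntegral.integral_neg] at h
  linarith

/-- D'Alembert representation of `z` on `I`: after the odd `2`-periodic extension in space,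
the Riemann invariant `ρ` at `(t, x)` is `H t (t + x)`, where `H · y` is `ρ` along the
characteristic `x = y - t` and `G` is the extended damping term; `ξ` at `(t, x)` is
`H t (t - x)`. -/
structure IsCharacteristicRep (a g : ℝ → ℝ) (I : Set ℝ) (z H G : ℝ → ℝ → ℝ) : Prop where
  continuous_H : Continuous H.uncurry
  continuous_G : Continuous G.uncurry
  periodic : ∀ t, Function.Periodic (H t) 2
  odd : ∀ t x, G t (-x) = - G t x
  hasDerivAt : ∀ t y, HasDerivAt (fun s => H s y) (- G t (y - t)) t
  source : ∀ t ∈ I, ∀ x ∈ Icc (0 : ℝ) 1, G t x = a x * g ((H t (t + x) - H t (t - x)) / 2)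
  rep : ∀ t ∈ I, ∀ x ∈ Icc (0 : ℝ) 1, z t x = (∫ y in (t - x)..(t + x), H t y) / 2

lemma interior_nonempty_of_nontrivial {I : Set ℝ} (hI : I.OrdConnected) (hn : I.Nontrivial) :
    (interior I).Nonempty := by
  obtain ⟨x, hx, y, hy, hxy⟩ := hn.exists_lt
  obtain ⟨m, hm⟩ := exists_between hxy
  exact ⟨m, interior_mono (hI.out hx hy) (by rw [interior_Icc]; exact hm)⟩

namespace IsCharacteristicRep

variable {a g : ℝ → ℝ} {I : Set ℝ} {z H G : ℝ → ℝ → ℝ}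

lemma continuous_slice (h : IsCharacteristicRep a g I z H G) (t : ℝ) : Continuous (H t) :=
  h.continuous_H.comp (Continuous.prodMk_right t)

lemma rep' (h : IsCharacteristicRep a g I z H G) {t : ℝ} (ht : t ∈ I) {x : ℝ}
    (hx : x ∈ Icc (0 : ℝ) 1) :
    z t x = ((∫ y in (0 : ℝ)..t + x, H t y) - ∫ y in (0 : ℝ)..t + -x, H t y) / 2 := by
  have hc := h.continuous_slice t
  rw [h.rep t ht x hx, intervalIntegral.integral_interval_sub_left
    (hc.intervalIntegrable _ _) (hc.intervalIntegrable _ _), sub_eq_add_neg]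

lemma hasDerivAt_space (h : IsCharacteristicRep a g I z H G) {t : ℝ} (ht : t ∈ I) {x : ℝ}
    (hx : x ∈ Ioo (0 : ℝ) 1) : HasDerivAt (z t) ((H t (t + x) + H t (t - x)) / 2) x := by
  have hc := h.continuous_slice t
  have hP : ∀ e, HasDerivAt (fun e => ∫ y in (0 : ℝ)..e, H t y) (H t e) e := fun e =>
    intervalIntegral.integral_hasDerivAt_right (hc.intervalIntegrable _ _)
      (hc.stronglyMeasurableAtFilter _ _) hc.continuousAt
  have h1 := (hP (t + x)).comp x ((hasDerivAt_id x).const_add t)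
  have h2 := (hP (t + -x)).comp x ((hasDerivAt_id x).neg.const_add t)
  refine (((h1.sub h2).div_const 2).congr_deriv ?_).congr_of_eventuallyEq ?_
  · rw [sub_eq_add_neg t x]; ring
  · filter_upwards [isOpen_Ioo.mem_nhds hx] with e he
    exact h.rep' ht (Ioo_subset_Icc_self he)

lemma continuous_source_along (h : IsCharacteristicRep a g I z H G) :
    Continuous (Function.uncurry fun t y => - G t (y - t)) :=
  (h.continuous_G.comp (continuous_fst.prodMk (continuous_snd.sub continuous_fst))).neg

lemma hasDerivWithinAt_time (h : IsCharacteristicRep a g I z H G) {t : ℝ} (ht : t ∈ I) {x : ℝ}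
    (hx : x ∈ Ioo (0 : ℝ) 1) :
    HasDerivWithinAt (fun s => z s x) ((H t (t + x) - H t (t - x)) / 2) I t := by
  have hx' := Ioo_subset_Icc_self hx
  have h1 := hasDerivAt_integral_moving_endpoint h.continuous_H h.continuous_source_along
    h.hasDerivAt x t
  have h2 := hasDerivAt_integral_moving_endpoint h.continuous_H h.continuous_source_along
    h.hasDerivAt (-x) t
  refine (((h1.sub h2).div_const 2).congr_deriv ?_).hasDerivWithinAt.congr
    (fun s hs => h.rep' hs hx') (h.rep' ht hx')
  have hG : Continuous (fun y => - G t (y - t)) :=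
    h.continuous_source_along.comp (Continuous.prodMk_right t)
  -- the damping term drops out because its extension is odd in space
  have h3 : (∫ y in (0 : ℝ)..t + x, - G t (y - t)) - ∫ y in (0 : ℝ)..t + -x, - G t (y - t) = 0 := by
    rw [intervalIntegral.integral_interval_sub_left (hG.intervalIntegrable _ _)
      (hG.intervalIntegrable _ _), intervalIntegral.integral_neg,
      intervalIntegral.integral_comp_sub_right (fun y => G t y)]
    simp [integral_neg_self_of_odd (h.odd t)]
  rw [sub_eq_add_neg t x]
  linear_combination h3 / 2

lemma riemann_eq (h : IsCharacteristicRep a g I z H G) (hI : I.OrdConnected)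
    (hn : I.Nontrivial) {t : ℝ} (ht : t ∈ I) {x : ℝ}
    (hx : x ∈ Ioo (0 : ℝ) 1) :
    riemannRho I z t x = H t (t + x) ∧ riemannXi I z t x = H t (t - x) := by
  have hu : UniqueDiffOn ℝ I :=
    uniqueDiffOn_convex hI.convex (interior_nonempty_of_nontrivial hI hn)
  have e1 := (h.hasDerivAt_space ht hx).deriv
  have e2 := (h.hasDerivWithinAt_time ht hx).derivWithin (hu t ht)
  constructor
  · rw [riemannRho, partialX, partialT, e1, e2]; ring
  · rw [riemannXi, partialX, partialT, e1, e2]; ring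

end IsCharacteristicRep

/-! ### Functionals of the Riemann invariants -/

namespace IsCharacteristicRep

variable {a g : ℝ → ℝ} {I : Set ℝ} {z H G : ℝ → ℝ → ℝ}

/-- Continuous functions of the Riemann invariants are integrable over the unit interval. -/
lemma integrableOn_comp (h : IsCharacteristicRep a g I z H G) (hI : I.OrdConnected)
    (hn : I.Nontrivial) {F : ℝ → ℝ} (hF : Continuous F) {t : ℝ} (ht : t ∈ I) :
    IntegrableOn (fun x => F (riemannRho I z t x)) (Ioo 0 1) ∧
      IntegrableOn (fun x => F (riemannXi I z t x)) (Ioo 0 1) := by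
  have hc := h.continuous_slice t
  constructor
  · have h1 : Continuous (fun x => F (H t (t + x))) := by fun_prop
    refine (integrableOn_congr_fun (fun x hx => ?_) measurableSet_Ioo).1
      ((h1.integrableOn_Icc (a := 0) (b := 1)).mono_set Ioo_subset_Icc_self)
    simp only [(h.riemann_eq hI hn ht hx).1]
  · have h1 : Continuous (fun x => F (H t (t - x))) := by fun_prop
    refine (integrableOn_congr_fun (fun x hx => ?_) measurableSet_Ioo).1
      ((h1.integrableOn_Icc (a := 0) (b := 1)).mono_set Ioo_subset_Icc_self)
    simp only [(h.riemann_eq hI hn ht hx).2]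

/-- Both Riemann invariants together form one function on a period, which may be read along
characteristics. -/
lemma setIntegral_comp_add (h : IsCharacteristicRep a g I z H G) (hI : I.OrdConnected)
    (hn : I.Nontrivial) {F : ℝ → ℝ} (hF : Continuous F) {t : ℝ} (ht : t ∈ I) :
    ∫ x in Ioo (0 : ℝ) 1, (F (riemannRho I z t x) + F (riemannXi I z t x)) =
      ∫ y in (-1 : ℝ)..1, F (H t y) := by
  have hc := h.continuous_slice t
  have hper : Function.Periodic (fun y => F (H t y)) 2 := fun y => by simp only [h.periodic t y]
  rw [hper.integral_neg_one_one t, integral_neg_one_one_eq (by fun_prop), ← integral_spaceMeasure,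
    spaceMeasure]
  refine setIntegral_congr_fun measurableSet_Ioo fun x hx => ?_
  simp only [(h.riemann_eq hI hn ht hx).1, (h.riemann_eq hI hn ht hx).2]
  rw [add_comm x, add_comm (-x), ← sub_eq_add_neg]

lemma dissipation_eq (h : IsCharacteristicRep a g I z H G) (hI : I.OrdConnected)
    (hn : I.Nontrivial) (F : ℝ → ℝ) {t : ℝ} (ht : t ∈ I) {x : ℝ} (hx : x ∈ Ioo (0 : ℝ) 1) :
    dissipation F a g I z t x = G t x * (deriv F (H t (t + x)) - deriv F (H t (t - x))) := by
  rw [dissipation, (h.riemann_eq hI hn ht hx).1, (h.riemann_eq hI hn ht hx).2,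
    h.source t ht x (Ioo_subset_Icc_self hx)]

lemma integrableOn_dissipation (h : IsCharacteristicRep a g I z H G) (hI : I.OrdConnected)
    (hn : I.Nontrivial) {F : ℝ → ℝ} (hF : ContDiff ℝ 1 F) {t : ℝ} (ht : t ∈ I) :
    IntegrableOn (dissipation F a g I z t) (Ioo 0 1) := by
  have hc := h.continuous_slice t
  have hG : Continuous (G t) := h.continuous_G.comp (Continuous.prodMk_right t)
  have hF' : Continuous (deriv F) := hF.continuous_deriv le_rfl
  have h1 : Continuous (fun x => G t x * (deriv F (H t (t + x)) - deriv F (H t (t - x)))) := by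
    fun_prop
  refine (integrableOn_congr_fun (fun x hx => ?_) measurableSet_Ioo).1
      ((h1.integrableOn_Icc (a := 0) (b := 1)).mono_set Ioo_subset_Icc_self)
  exact (h.dissipation_eq hI hn F ht hx).symm

lemma hasDerivWithinAt_convexFunctional (h : IsCharacteristicRep a g I z H G)
    (hI : I.OrdConnected) (hn : I.Nontrivial) {F : ℝ → ℝ} (hF : ContDiff ℝ 1 F) {t : ℝ}
    (ht : t ∈ I) :
    HasDerivWithinAt (convexFunctional F I z)
      (- ∫ x in Ioo (0 : ℝ) 1, dissipation F a g I z t x) I t := by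
  have hF' : Continuous (deriv F) := hF.continuous_deriv le_rfl
  have hG := h.continuous_source_along
  have h1 := hasDerivAt_integral_of_continuous (f := fun s y => F (H s y))
    (f' := fun s y => deriv F (H s y) * - G s (y - s)) (hF.continuous.comp h.continuous_H)
    ((hF'.comp h.continuous_H).mul hG)
    (fun s y => ((hF.differentiable (by simp) (H s y)).hasDerivAt.comp s (h.hasDerivAt s y)))
    (-1) 1 t
  refine (h1.congr_deriv ?_).hasDerivWithinAt.congr
    (fun s hs => h.setIntegral_comp_add hI hn hF.continuous hs)
    (h.setIntegral_comp_add hI hn hF.continuous ht)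
  have hc := h.continuous_slice t
  have hGt : Continuous (G t) := h.continuous_G.comp (Continuous.prodMk_right t)
  -- differentiating the periodicity of `H` in time gives that of `G`
  have hGper : Function.Periodic (fun y => G t (y - t)) 2 := by
    intro y
    have e1 := h.hasDerivAt t (y + 2)
    have e2 := (h.hasDerivAt t y).congr_of_eventuallyEq
      (Filter.Eventually.of_forall fun s => h.periodic s y)
    exact neg_injective (e1.unique e2)
  have hper : Function.Periodic (fun y => deriv F (H t y) * - G t (y - t)) 2 := by
    intro y
    have e := hGper y
    simp only at e ⊢
    rw [h.periodic t y, e]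
  rw [hper.integral_neg_one_one t]
  simp only [add_sub_cancel_right]
  rw [integral_neg_one_one_eq (by fun_prop), ← integral_spaceMeasure, spaceMeasure, ← integral_neg]
  refine setIntegral_congr_fun measurableSet_Ioo fun x hx => ?_
  rw [h.dissipation_eq hI hn F ht hx, h.odd t x, add_comm x, add_comm (-x), ← sub_eq_add_neg]
  ring

/-- The dissipation is nonnegative since `F'` and `g` are nondecreasing and `g 0 = 0`. -/
lemma _root_.dissipation_nonneg (ha : ∀ x ∈ Icc (0 : ℝ) 1, 0 ≤ a x) (hg : Monotone g)
    (hg0 : g 0 = 0) {F : ℝ → ℝ} (hF : ContDiff ℝ 1 F) (hFc : ConvexOn ℝ univ F) (t : ℝ) {x : ℝ}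
    (hx : x ∈ Icc (0 : ℝ) 1) : 0 ≤ dissipation F a g I z t x := by
  have hm := hFc.monotoneOn_deriv fun y _ => hF.differentiable (by simp) y
  rw [dissipation, mul_assoc]
  refine mul_nonneg (ha x hx) ?_
  rcases le_total (riemannXi I z t x) (riemannRho I z t x) with hle | hle
  · refine mul_nonneg ?_ (sub_nonneg.2 (hm (mem_univ _) (mem_univ _) hle))
    rw [← hg0]
    exact hg (by linarith)
  · refine mul_nonneg_of_nonpos_of_nonpos ?_ (sub_nonpos.2 (hm (mem_univ _) (mem_univ _) hle))
    rw [← hg0]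
    exact hg (by linarith)

lemma antitoneOn_convexFunctional (h : IsCharacteristicRep a g I z H G)
    (ha : ∀ x ∈ Icc (0 : ℝ) 1, 0 ≤ a x) (hg : Monotone g) (hg0 : g 0 = 0)
    (hI : I.OrdConnected) (hn : I.Nontrivial) {F : ℝ → ℝ} (hF : ContDiff ℝ 1 F)
    (hFc : ConvexOn ℝ univ F) : AntitoneOn (convexFunctional F I z) I := by
  have hd := fun t ht => h.hasDerivWithinAt_convexFunctional hI hn hF (t := t) ht
  refine antitoneOn_of_hasDerivWithinAt_nonpos hI.convex
    (fun t ht => (hd t ht).continuousWithinAt)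
    (fun t ht => (hd t (interior_subset ht)).mono interior_subset) fun t _ => ?_
  exact neg_nonpos.2 (setIntegral_nonneg measurableSet_Ioo fun x hx =>
    dissipation_nonneg ha hg hg0 hF hFc t (Ioo_subset_Icc_self hx))

/-- For `q > 1` this is the case `F = |·| ^ q`; the exponent `p = 1`, for which `|·|` is not
differentiable, is reached by letting `q` decrease to `p`. -/
lemma antitoneOn_pEnergy (h : IsCharacteristicRep a g I z H G)
    (ha : ∀ x ∈ Icc (0 : ℝ) 1, 0 ≤ a x) (hg : Monotone g) (hg0 : g 0 = 0)
    (hI : I.OrdConnected) (hn : I.Nontrivial) {p : ℝ} (hp : 1 ≤ p) :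
    AntitoneOn (pEnergy p I z) I := by
  have hcont : ∀ q : ℝ, 0 ≤ q → Continuous (fun r : ℝ => |r| ^ q) := fun q hq =>
    continuous_abs.rpow_const fun _ => Or.inr hq
  have hlim : ∀ t, Filter.Tendsto (fun q : ℝ => ∫ y in (-1 : ℝ)..1, |H t y| ^ q)
      (nhdsWithin p (Ioi p)) (nhds (∫ y in (-1 : ℝ)..1, |H t y| ^ p)) := by
    intro t
    have hc := h.continuous_slice t
    obtain ⟨B, hB⟩ := (isCompact_uIcc (a := (-1 : ℝ)) (b := 1)).exists_bound_of_continuousOn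
      hc.continuousOn
    refine intervalIntegral.tendsto_integral_filter_of_dominated_convergence
      (fun _ => (1 + |B|) ^ (p + 1)) ?_ ?_ intervalIntegrable_const ?_
    · filter_upwards [self_mem_nhdsWithin] with q hq
      exact ((hcont q (by linarith [hq.out])).comp hc).aestronglyMeasurable
    · filter_upwards [self_mem_nhdsWithin,
        mem_nhdsWithin_of_mem_nhds (Iio_mem_nhds (lt_add_one p))] with q hq hq'
      refine Filter.Eventually.of_forall fun y hy => ?_
      have h1 := (hB y (uIoc_subset_uIcc hy)).trans (le_abs_self B)
      rw [Real.norm_eq_abs] at h1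
      rw [Real.norm_of_nonneg (by positivity)]
      calc |H t y| ^ q ≤ (1 + |B|) ^ q :=
            Real.rpow_le_rpow (abs_nonneg _) (by linarith) (by linarith [hq.out])
        _ ≤ (1 + |B|) ^ (p + 1) :=
            Real.rpow_le_rpow_of_exponent_le (by linarith [abs_nonneg B]) hq'.out.le
    · refine Filter.Eventually.of_forall fun y _ => ?_
      refine ((Real.continuousAt_const_rpow' (by linarith)).tendsto).mono_left nhdsWithin_le_nhds
  have hq : ∀ q : ℝ, 1 < q → ∀ s ∈ I, ∀ t ∈ I, s ≤ t →
      ∫ y in (-1 : ℝ)..1, |H t y| ^ q ≤ ∫ y in (-1 : ℝ)..1, |H s y| ^ q := by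
    intro q hq s hs t ht hst
    have hF : ContDiff ℝ 1 (fun r : ℝ => |r| ^ q) := contDiff_norm_rpow (E := ℝ) hq
    have hFc : ConvexOn ℝ univ (fun r : ℝ => |r| ^ q) := by
      refine ((convexOn_rpow hq.le).subset (image_subset_iff.2 fun r _ => abs_nonneg r) ?_).comp
        (convexOn_norm convex_univ) ?_
      · rw [image_univ]
        exact (isPreconnected_range continuous_abs).ordConnected.convex
      · exact (Real.monotoneOn_rpow_Ici_of_exponent_nonneg (by linarith)).mono
          (image_subset_iff.2 fun r _ => abs_nonneg r)
    have := h.antitoneOn_convexFunctional ha hg hg0 hI hn hF hFc hs ht hst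
    rw [convexFunctional, convexFunctional,
      h.setIntegral_comp_add hI hn hF.continuous hs,
      h.setIntegral_comp_add hI hn hF.continuous ht] at this
    exact this
  have he : ∀ t ∈ I, pEnergy p I z t = (1 / p) * ∫ y in (-1 : ℝ)..1, |H t y| ^ p := fun t ht => by
    rw [← h.setIntegral_comp_add hI hn (hcont p (by linarith)) ht]
    rfl
  intro s hs t ht hst
  rw [he s hs, he t ht]
  refine mul_le_mul_of_nonneg_left ?_ (by positivity)
  refine le_of_tendsto_of_tendsto (hlim t) (hlim s) ?_
  filter_upwards [self_mem_nhdsWithin] with q hq'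
  exact hq q (lt_of_le_of_lt hp hq') s hs t ht hst

end IsCharacteristicRep

/-! ### The weak equation as an ordinary differential equation for sine coefficients -/

lemma restrict_prod_eq (I : Set ℝ) :
    volume.restrict (I ×ˢ Ioo (0 : ℝ) 1) = (volume.restrict I).prod spaceMeasure := by
  rw [spaceMeasure, Measure.prod_restrict, Measure.volume_eq_prod]

/-- The function `u` belongs to `L^∞(I, L¹(0,1))` with norm at most `M`. -/
structure IsBoundedL1 (I : Set ℝ) (u : ℝ → ℝ → ℝ) (M : ℝ) : Prop where
  meas : JointlyMeasurable I u
  bound : ∀ᵐ t ∂(volume.restrict I), Integrable (u t) spaceMeasure ∧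
    ∫ x, ‖u t x‖ ∂spaceMeasure ≤ M

namespace IsBoundedL1

variable {I : Set ℝ} {u ut : ℝ → ℝ → ℝ} {M M' : ℝ}

lemma aestronglyMeasurable (h : IsBoundedL1 I u M) :
    AEStronglyMeasurable (Function.uncurry u) ((volume.restrict I).prod spaceMeasure) := by
  rw [← restrict_prod_eq]
  exact h.meas

lemma integrable_mul_mul (h : IsBoundedL1 I u M) {φ ψ : ℝ → ℝ}
    (hφ : Integrable φ (volume.restrict I)) (hψ : Continuous ψ) (hψ1 : ∀ x, |ψ x| ≤ 1) :
    Integrable (Function.uncurry fun t x => φ t * (u t x * ψ x))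
      ((volume.restrict I).prod spaceMeasure) := by
  have hm : AEStronglyMeasurable (Function.uncurry fun t x => φ t * (u t x * ψ x))
      ((volume.restrict I).prod spaceMeasure) :=
    (hφ.1.comp_fst).mul (h.aestronglyMeasurable.mul (hψ.comp continuous_snd).aestronglyMeasurable)
  refine (integrable_prod_iff hm).2 ⟨?_, ?_⟩
  · filter_upwards [h.bound] with t ht
    exact ((ht.1.mul_bdd (c := 1) hψ.aestronglyMeasurable
      (Filter.Eventually.of_forall hψ1))).const_mul (φ t)
  · refine Integrable.mono' (hφ.norm.mul_const M) hm.norm.integral_prod_right' ?_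
    filter_upwards [h.bound] with t ht
    rw [Real.norm_of_nonneg (integral_nonneg fun x => norm_nonneg _)]
    simp only [Function.uncurry, norm_mul]
    rw [integral_const_mul]
    refine mul_le_mul_of_nonneg_left (le_trans ?_ ht.2) (norm_nonneg _)
    refine integral_mono_of_nonneg (Filter.Eventually.of_forall fun x => by positivity) ht.1.norm
      (Filter.Eventually.of_forall fun x => ?_)
    exact mul_le_of_le_one_right (norm_nonneg _) (hψ1 x)

/-- The time dependent coefficient `∫ u(t,x) ψ(x) dx` is locally integrable. -/
lemma locallyIntegrableOn_coeff (h : IsBoundedL1 I u M) {ψ : ℝ → ℝ}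
    (hψ : Continuous ψ) (hψ1 : ∀ x, |ψ x| ≤ 1) :
    LocallyIntegrableOn (fun t => ∫ x, u t x * ψ x ∂spaceMeasure) I := by
  have hm : AEStronglyMeasurable (fun t => ∫ x, u t x * ψ x ∂spaceMeasure)
      (volume.restrict I) :=
    (h.aestronglyMeasurable.mul
      (hψ.comp continuous_snd).aestronglyMeasurable).integral_prod_right'
  have hb : ∀ᵐ t ∂(volume.restrict I), ‖∫ x, u t x * ψ x ∂spaceMeasure‖ ≤ M := by
    filter_upwards [h.bound] with t ht
    refine (norm_integral_le_integral_norm _).trans (le_trans ?_ ht.2)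
    refine integral_mono_of_nonneg (Filter.Eventually.of_forall fun x => norm_nonneg _) ht.1.norm
      (Filter.Eventually.of_forall fun x => ?_)
    simp only [norm_mul]
    exact mul_le_of_le_one_right (norm_nonneg _) (hψ1 x)
  have hg : LocallyIntegrableOn (fun _ : ℝ => M) I := locallyIntegrableOn_const M
  intro t ht
  obtain ⟨U, hU, hUi⟩ := hg t ht
  obtain ⟨U', hU', hUs⟩ : ∃ U' ∈ nhdsWithin t I, U' ⊆ U ∩ I :=
    ⟨U ∩ I, Filter.inter_mem hU self_mem_nhdsWithin, subset_rfl⟩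
  refine ⟨U', hU', ?_⟩
  exact Integrable.mono' (hUi.mono_set (hUs.trans inter_subset_left))
    (hm.mono_measure (Measure.restrict_mono (hUs.trans inter_subset_right) le_rfl))
    (ae_restrict_of_ae_restrict_of_subset (hUs.trans inter_subset_right) hb)

/-- Fubini turns the weak time derivative of `u` into one of its coefficients. -/
lemma integral_deriv_mul_coeff (h : IsBoundedL1 I u M) (h' : IsBoundedL1 I ut M')
    (hw : HasWeakTimeDeriv I u ut) {φ ψ : ℝ → ℝ} (hφ : IsTestFun (interior I) φ)
    (hψ : Continuous ψ) (hψ1 : ∀ x, |ψ x| ≤ 1) :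
    ∫ t in I, deriv φ t * ∫ x, u t x * ψ x ∂spaceMeasure =
      - ∫ t in I, φ t * ∫ x, ut t x * ψ x ∂spaceMeasure := by
  have hφi : Integrable φ (volume.restrict I) :=
    (hφ.continuous.integrable_of_hasCompactSupport hφ.2.1).restrict
  have hφ'i : Integrable (deriv φ) (volume.restrict I) :=
    (hφ.continuous_deriv.integrable_of_hasCompactSupport hφ.2.1.deriv).restrict
  simp only [← integral_const_mul]
  rw [integral_integral_swap (h.integrable_mul_mul hφ'i hψ hψ1),
    integral_integral_swap (h'.integrable_mul_mul hφi hψ hψ1), ← integral_neg]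
  refine integral_congr_ae ?_
  filter_upwards [hw φ hφ] with x hx
  simp only [← mul_assoc, integral_mul_const]
  rw [hx, neg_mul]

end IsBoundedL1

lemma IsTestFun.mul_contDiff {U : Set ℝ} {φ ψ : ℝ → ℝ} (h : IsTestFun U φ) (hψ : ContDiff ℝ ∞ ψ) :
    IsTestFun U (fun x => φ x * ψ x) :=
  ⟨h.1.mul hψ, h.2.1.mul_right, (tsupport_mul_subset_left (f := φ) (g := ψ)).trans h.2.2⟩

/-- Variation of constants for the weak oscillator `c'' + κ² c = -f`: the Fourier coefficient
`2 κ c cos(κ t + θ) - 2 c' sin(κ t + θ)` of a Riemann invariant read along characteristics changes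
only through the source `f`. -/
lemma exists_const_of_weak_oscillator {J : Set ℝ} (hJ : IsOpen J) (hc : J.OrdConnected)
    (h0 : J ⊆ Ici 0) {c d e f : ℝ → ℝ} (hci : LocallyIntegrableOn c J)
    (hdi : LocallyIntegrableOn d J) (hf : Measurable f) {B : ℝ} (hfB : ∀ t, |f t| ≤ B) (κ θ : ℝ)
    (hcd : ∀ φ, IsTestFun J φ → ∫ t in J, deriv φ t * c t = - ∫ t in J, φ t * d t)
    (hde : ∀ φ, IsTestFun J φ → ∫ t in J, deriv φ t * d t = - ∫ t in J, φ t * e t)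
    (he : ∀ᵐ t ∂(volume.restrict J), e t = - κ ^ 2 * c t - f t) :
    ∃ C : ℝ, ∀ᵐ t ∂(volume.restrict J),
      2 * κ * c t * Real.cos (κ * t + θ) - 2 * d t * Real.sin (κ * t + θ) =
        C + ∫ s in (0 : ℝ)..t, 2 * Real.sin (κ * s + θ) * f s := by
  have hsin : ContDiff ℝ ∞ (fun t => Real.sin (κ * t + θ)) := by fun_prop
  have hcos : ContDiff ℝ ∞ (fun t => Real.cos (κ * t + θ)) := by fun_prop
  have dlin : ∀ t, HasDerivAt (fun t : ℝ => κ * t + θ) κ t := fun t => by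
    simpa using ((hasDerivAt_id t).const_mul κ).add_const θ
  have hloc : LocallyIntegrable f volume := by
    intro x
    refine ⟨Icc (x - 1) (x + 1), Icc_mem_nhds (by linarith) (by linarith), ?_⟩
    exact Measure.integrableOn_of_bounded (M := B) (by simp)
      hf.aestronglyMeasurable (Filter.Eventually.of_forall hfB)
  have hint : ∀ a b, IntervalIntegrable (fun s => 2 * Real.sin (κ * s + θ) * f s) volume a b :=
    fun a b => ((hloc.integrableOn_isCompact isCompact_uIcc).intervalIntegrable).continuousOn_mul
      (by fun_prop)
  refine exists_ae_eq_const_add_primitive hJ hc h0 ?_ hint ?_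
  · have h1 := hci.continuousOn_mul (g := fun t => 2 * κ * Real.cos (κ * t + θ))
      (by fun_prop) hJ.isLocallyClosed
    have h2 := hdi.continuousOn_mul (g := fun t => 2 * Real.sin (κ * t + θ))
      (by fun_prop) hJ.isLocallyClosed
    convert h1.sub h2 using 1
    ext t
    simp only [Pi.sub_apply]
    ring
  intro φ hφ
  have hφ' : IsTestFun J (deriv φ) :=
    ⟨(contDiff_infty_iff_deriv.1 hφ.1).2, hφ.2.1.deriv,
      (tsupport_deriv_subset (f := φ)).trans hφ.2.2⟩
  have hfl := hloc.locallyIntegrableOn J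
  have dφ : ∀ t, HasDerivAt φ (deriv φ t) t := fun t =>
    (hφ.1.differentiable (by simp) t).hasDerivAt
  have d1 : deriv (fun t => φ t * Real.cos (κ * t + θ)) =
      fun t => deriv φ t * Real.cos (κ * t + θ) - κ * (φ t * Real.sin (κ * t + θ)) := by
    ext t; rw [((dφ t).fun_mul (dlin t).cos).deriv]; ring
  have d2 : deriv (fun t => φ t * Real.sin (κ * t + θ)) =
      fun t => deriv φ t * Real.sin (κ * t + θ) + κ * (φ t * Real.cos (κ * t + θ)) := by
    ext t; rw [((dφ t).fun_mul (dlin t).sin).deriv]; ring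
  -- the oscillating factors are absorbed into the test functions
  have h1 := hcd _ (hφ.mul_contDiff hcos)
  have h2 := hde _ (hφ.mul_contDiff hsin)
  rw [d1] at h1
  rw [d2] at h2
  have i1 := ((hφ'.mul_contDiff hcos).integrable_mul hci).restrict (s := J)
  have i2 := ((hφ.mul_contDiff hsin).integrable_mul hci).restrict (s := J)
  have i3 := ((hφ'.mul_contDiff hsin).integrable_mul hdi).restrict (s := J)
  have i4 := ((hφ.mul_contDiff hcos).integrable_mul hdi).restrict (s := J)
  have i5 := ((hφ.mul_contDiff hsin).integrable_mul hfl).restrict (s := J)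
  have e1 : ∫ t in J, (deriv φ t * Real.cos (κ * t + θ) - κ * (φ t * Real.sin (κ * t + θ))) * c t =
      (∫ t in J, deriv φ t * Real.cos (κ * t + θ) * c t) -
        κ * ∫ t in J, φ t * Real.sin (κ * t + θ) * c t := by
    rw [← integral_const_mul, ← integral_sub i1 (i2.const_mul κ)]
    congr 1; ext t; ring
  have e2 : ∫ t in J, (deriv φ t * Real.sin (κ * t + θ) + κ * (φ t * Real.cos (κ * t + θ))) * d t =
      (∫ t in J, deriv φ t * Real.sin (κ * t + θ) * d t) +
        κ * ∫ t in J, φ t * Real.cos (κ * t + θ) * d t := by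
    rw [← integral_const_mul, ← integral_add i3 (i4.const_mul κ)]
    congr 1; ext t; ring
  have e3 : ∫ t in J, φ t * Real.sin (κ * t + θ) * e t =
      - κ ^ 2 * (∫ t in J, φ t * Real.sin (κ * t + θ) * c t) -
        ∫ t in J, φ t * Real.sin (κ * t + θ) * f t := by
    rw [← integral_const_mul, ← integral_sub (i2.const_mul _) i5]
    refine integral_congr_ae ?_
    filter_upwards [he] with t ht
    rw [ht]; ring
  have e4 : ∫ t in J, deriv φ t *
      (2 * κ * c t * Real.cos (κ * t + θ) - 2 * d t * Real.sin (κ * t + θ)) =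
      2 * κ * (∫ t in J, deriv φ t * Real.cos (κ * t + θ) * c t) -
        2 * ∫ t in J, deriv φ t * Real.sin (κ * t + θ) * d t := by
    rw [← integral_const_mul, ← integral_const_mul,
      ← integral_sub (i1.const_mul _) (i3.const_mul _)]
    congr 1; ext t; ring
  have e5 : ∫ t in J, φ t * (2 * Real.sin (κ * t + θ) * f t) =
      2 * ∫ t in J, φ t * Real.sin (κ * t + θ) * f t := by
    rw [← integral_const_mul]
    congr 1; ext t; ring
  rw [e1] at h1
  rw [e2, e3] at h2
  rw [e4, e5]
  linear_combination 2 * κ * h1 - 2 * h2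

/-! ### Continuous representatives of the velocity and of the source -/

/-- The velocity has a representative that is measurable in time, continuous in space at every
time, uniformly bounded, and zero at the end points. -/
lemma exists_velocity_rep {I : Set ℝ} {w wx : ℝ → ℝ → ℝ} {M : ℝ} (hM : 0 ≤ M)
    (hwx : IsBoundedL1 I wx M)
    (hw : ∀ᵐ t ∂(volume.restrict I), (∀ᵐ x ∂spaceMeasure, w t x = ∫ y in (0 : ℝ)..x, wx t y) ∧
      ∫ x, wx t x ∂spaceMeasure = 0) :
    ∃ v : ℝ → ℝ → ℝ, (∀ x, StronglyMeasurable fun t => v t x) ∧ (∀ t, Continuous (v t)) ∧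
      (∀ t, v t 0 = 0 ∧ v t 1 = 0) ∧ (∀ t, ∀ x ∈ Icc (0 : ℝ) 1, |v t x| ≤ M) ∧
      ∀ᵐ t ∂(volume.restrict I), ∀ᵐ x ∂spaceMeasure, w t x = v t x := by
  have hm := hwx.aestronglyMeasurable
  obtain ⟨k, hk, hke⟩ := hm
  have hke' := Measure.ae_ae_of_ae_prod hke
  have hkc : StronglyMeasurable (Function.uncurry fun t x => k (t, x)) := hk
  -- only times at which the representative of `w_x` is admissible are kept
  set S : Set ℝ := {t | Integrable (fun x => k (t, x)) spaceMeasure} ∩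
    ({t | ∫ x, ‖k (t, x)‖ ∂spaceMeasure ≤ M} ∩ {t | ∫ x, k (t, x) ∂spaceMeasure = 0})
  have hSm : MeasurableSet S := by
    refine (measurableSet_integrable hkc).inter (MeasurableSet.inter ?_ ?_)
    · exact measurableSet_le (hkc.norm.integral_prod_right).measurable measurable_const
    · exact (hkc.integral_prod_right).measurable (measurableSet_singleton 0)
  set K : ℝ × ℝ → ℝ := (S ×ˢ Ioo (0 : ℝ) 1).indicator k with hK
  have hKm : StronglyMeasurable K := hk.indicator (hSm.prod measurableSet_Ioo)
  have hK1 : ∀ t ∈ S, (fun x => K (t, x)) = (Ioo (0 : ℝ) 1).indicator fun x => k (t, x) := by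
    intro t ht
    ext x
    by_cases hx : x ∈ Ioo (0 : ℝ) 1
    · rw [indicator_of_mem hx, hK, indicator_of_mem (mk_mem_prod ht hx)]
    · rw [indicator_of_notMem hx, hK, indicator_of_notMem fun h => hx h.2]
  have hK0 : ∀ t ∉ S, (fun x => K (t, x)) = fun _ => 0 := by
    intro t ht
    ext x
    rw [hK, indicator_of_notMem fun h => ht h.1]
  have hKi : ∀ t, Integrable (fun x => K (t, x)) := by
    intro t
    by_cases ht : t ∈ S
    · rw [hK1 t ht, integrable_indicator_iff measurableSet_Ioo]
      exact ht.1
    · rw [hK0 t ht]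
      exact integrable_zero _ _ _
  have hKk : ∀ t ∈ S, ∀ᵐ x ∂spaceMeasure, K (t, x) = k (t, x) := by
    intro t ht
    filter_upwards [ae_mem_Ioo_spaceMeasure] with x hx
    rw [hK, indicator_of_mem (mk_mem_prod ht hx)]
  refine ⟨fun t x => ∫ y in (0 : ℝ)..x, K (t, y), ?_, ?_, ?_, ?_, ?_⟩
  · intro x
    have hKc : StronglyMeasurable (Function.uncurry fun t x => K (t, x)) := hKm
    simp only [intervalIntegral]
    exact hKc.integral_prod_right.sub hKc.integral_prod_right
  · exact fun t => intervalIntegral.continuous_primitive (fun a b => (hKi t).intervalIntegrable) 0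
  · intro t
    refine ⟨by simp, ?_⟩
    change ∫ y in (0 : ℝ)..1, K (t, y) = 0
    rw [← integral_spaceMeasure]
    by_cases ht : t ∈ S
    · rw [integral_congr_ae (hKk t ht)]
      exact ht.2.2
    · simp only [congrFun (hK0 t ht), integral_zero]
  · intro t x hx
    refine (abs_primitive_le (hKi t).restrict hx).trans ?_
    by_cases ht : t ∈ S
    · refine le_of_eq_of_le (integral_congr_ae ?_) ht.2.1
      filter_upwards [hKk t ht] with y hy
      rw [hy]
    · simpa only [congrFun (hK0 t ht), norm_zero, integral_zero] using hM
  · filter_upwards [hw, hke', hwx.bound] with t ht1 ht2 ht3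
    have hS' : t ∈ S := by
      refine ⟨(integrable_congr ht2).1 ht3.1, ?_, ?_⟩
      · refine le_of_eq_of_le (integral_congr_ae ?_) ht3.2
        filter_upwards [ht2] with y hy
        rw [← hy]; rfl
      · refine Eq.trans (integral_congr_ae ?_) ht1.2
        filter_upwards [ht2] with y hy
        rw [← hy]; rfl
    filter_upwards [ht1.1, ae_mem_Ioo_spaceMeasure] with x hx hx01
    rw [hx]
    refine intervalIntegral.integral_congr_ae_restrict ?_
    rw [uIoc_of_le hx01.1.le]
    have hsub : (Ioc 0 x) ⊆ Ioo (0 : ℝ) 1 := fun y hy => ⟨hy.1, hy.2.trans_lt hx01.2⟩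
    refine ae_restrict_of_ae_restrict_of_subset hsub ?_
    filter_upwards [hKk t hS', ht2] with y hy1 hy2
    rw [hy1, ← hy2]; rfl

/-- A source on `[0,1]` that is measurable in time, continuous in space at every time, uniformly
bounded, and zero at the end points. -/
structure IsAdmissibleSource (q : ℝ → ℝ → ℝ) (B : ℝ) : Prop where
  meas : ∀ x, StronglyMeasurable fun t => q t x
  cont : ∀ t, Continuous (q t)
  zero : ∀ t, q t 0 = 0 ∧ q t 1 = 0
  bound : ∀ t, ∀ x ∈ Icc (0 : ℝ) 1, |q t x| ≤ B

/-- The integral along the characteristic through `y` of the odd periodic extension of `q`. -/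
noncomputable def characteristicIntegral (q : ℝ → ℝ → ℝ) (t y : ℝ) : ℝ :=
  ∫ s in (0 : ℝ)..t, periodicExt 0 (q s) (y - s)

namespace IsAdmissibleSource

variable {q : ℝ → ℝ → ℝ} {B : ℝ}

lemma nonneg (h : IsAdmissibleSource q B) : 0 ≤ B :=
  (abs_nonneg _).trans (h.bound 0 0 (by simp))

lemma continuous_ext (h : IsAdmissibleSource q B) (t : ℝ) : Continuous (periodicExt 0 (q t)) :=
  continuous_periodicExt continuous_zero (h.cont t) (h.zero t).1 (h.zero t).2

lemma abs_ext_le (h : IsAdmissibleSource q B) (t x : ℝ) : |periodicExt 0 (q t) x| ≤ B := by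
  simp only [periodicExt, Pi.zero_apply, zero_add, abs_mul]
  calc |squareWave x| * |q t (triangleWave x)| ≤ 1 * B :=
        mul_le_mul (abs_squareWave_le x) (h.bound t _ (triangleWave_mem x)) (abs_nonneg _)
          zero_le_one
    _ = B := one_mul B

lemma stronglyMeasurable_along (h : IsAdmissibleSource q B) :
    StronglyMeasurable (Function.uncurry fun y s => periodicExt 0 (q s) (y - s)) := by
  have h0 : ∀ x, StronglyMeasurable fun t => periodicExt 0 (q t) x := fun x => by
    simp only [periodicExt, Pi.zero_apply, zero_add]
    exact (h.meas _).const_mul _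
  have h1 := stronglyMeasurable_uncurry_of_continuous_of_stronglyMeasurable
    (u := fun x t => periodicExt 0 (q t) x) (fun t => h.continuous_ext t) h0
  have h2 : Measurable (fun r : ℝ × ℝ => (r.1 - r.2, r.2)) :=
    (measurable_fst.sub measurable_snd).prodMk measurable_snd
  have h3 := h1.comp_measurable h2
  have h4 : (Function.uncurry fun y s => periodicExt 0 (q s) (y - s)) =
      (Function.uncurry fun x t => periodicExt 0 (q t) x) ∘ fun r : ℝ × ℝ => (r.1 - r.2, r.2) := by
    ext ⟨y, s⟩
    rfl
  rw [h4]
  exact h3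

lemma intervalIntegrable_along (h : IsAdmissibleSource q B) (y a b : ℝ) :
    IntervalIntegrable (fun s => periodicExt 0 (q s) (y - s)) volume a b := by
  refine (intervalIntegrable_const (c := B)).mono_fun
    (h.stronglyMeasurable_along.comp_measurable measurable_prodMk_left).aestronglyMeasurable
    (Filter.Eventually.of_forall fun s => ?_)
  exact (h.abs_ext_le _ _).trans (le_abs_self B)

lemma continuous_characteristicIntegral (h : IsAdmissibleSource q B) :
    Continuous (Function.uncurry (characteristicIntegral q)) := by
  refine continuous_prod_of_continuous_lipschitzWith _ (Real.toNNReal B) (fun t => ?_) fun y => ?_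
  · simp only [Function.uncurry, characteristicIntegral]
    refine intervalIntegral.continuous_of_dominated_interval (bound := fun _ => B)
      (fun y => (h.stronglyMeasurable_along.comp_measurable
        measurable_prodMk_left).aestronglyMeasurable)
      (fun y => Filter.Eventually.of_forall fun s _ => h.abs_ext_le _ _) intervalIntegrable_const
      (Filter.Eventually.of_forall fun s _ => ?_)
    exact (h.continuous_ext s).comp (continuous_id.sub continuous_const)
  · refine LipschitzWith.of_dist_le_mul fun t s => ?_
    simp only [Function.uncurry, characteristicIntegral]
    rw [Real.dist_eq, intervalIntegral.integral_interval_sub_left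
      (h.intervalIntegrable_along y _ _) (h.intervalIntegrable_along y _ _), Real.dist_eq,
      Real.coe_toNNReal B h.nonneg]
    exact intervalIntegral.norm_integral_le_of_norm_le_const
      (f := fun r => periodicExt 0 (q r) (y - r)) fun r _ => h.abs_ext_le r (y - r)

lemma periodic_characteristicIntegral (t : ℝ) :
    Function.Periodic (characteristicIntegral q t) 2 := fun y => by
  simp only [characteristicIntegral]
  congr 1
  ext s
  rw [← periodicExt_periodic 0 (q s) (y - s)]
  ring_nf

/-- The sine coefficients of an admissible source are measurable and bounded. -/
lemma measurable_coeff (h : IsAdmissibleSource q B) (κ : ℝ) :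
    Measurable (fun s => ∫ x in (0 : ℝ)..1, q s x * Real.sin (κ * x)) ∧
      ∀ s, |∫ x in (0 : ℝ)..1, q s x * Real.sin (κ * x)| ≤ B := by
  constructor
  · have h1 : StronglyMeasurable (Function.uncurry fun x t => q t x) :=
      stronglyMeasurable_uncurry_of_continuous_of_stronglyMeasurable h.cont h.meas
    have h2 : StronglyMeasurable (Function.uncurry fun t x => q t x) :=
      h1.comp_measurable measurable_swap
    have h3 : StronglyMeasurable (Function.uncurry fun t x => q t x * Real.sin (κ * x)) :=
      h2.mul (Continuous.stronglyMeasurable (by fun_prop))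
    simp only [← integral_spaceMeasure]
    exact h3.integral_prod_right.measurable
  · intro s
    have := intervalIntegral.norm_integral_le_of_norm_le_const (a := (0 : ℝ)) (b := 1) (C := B)
      (f := fun x => q s x * Real.sin (κ * x)) fun x hx => by
        rw [uIoc_of_le zero_le_one] at hx
        rw [norm_mul]
        calc ‖q s x‖ * ‖Real.sin (κ * x)‖ ≤ B * 1 :=
              mul_le_mul (h.bound s x (Ioc_subset_Icc_self hx)) (Real.abs_sin_le_one _)
                (norm_nonneg _) h.nonneg
          _ = B := mul_one B
    simpa using this

lemma integral_characteristicIntegral_mul_cos (h : IsAdmissibleSource q B) (k : ℤ) (θ t : ℝ) :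
    ∫ y in (-1 : ℝ)..1, characteristicIntegral q t y * Real.cos (k * Real.pi * y + θ) =
      - ∫ s in (0 : ℝ)..t, 2 * Real.sin (k * Real.pi * s + θ) *
        ∫ x in (0 : ℝ)..1, q s x * Real.sin (k * Real.pi * x) := by
  have hm : StronglyMeasurable (Function.uncurry fun y s =>
      periodicExt 0 (q s) (y - s) * Real.cos (k * Real.pi * y + θ)) :=
    h.stronglyMeasurable_along.mul (Continuous.stronglyMeasurable (by fun_prop))
  have hi : IntegrableOn (Function.uncurry fun y s =>
      periodicExt 0 (q s) (y - s) * Real.cos (k * Real.pi * y + θ))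
      (uIoc (-1 : ℝ) 1 ×ˢ uIoc 0 t) := by
    have hfin : volume (uIoc (-1 : ℝ) 1 ×ˢ uIoc 0 t) ≠ ⊤ := by
      rw [Measure.volume_eq_prod, Measure.prod_prod, uIoc, uIoc, Real.volume_Ioc, Real.volume_Ioc]
      exact ENNReal.mul_ne_top ENNReal.ofReal_ne_top ENNReal.ofReal_ne_top
    refine Measure.integrableOn_of_bounded (M := B) hfin hm.aestronglyMeasurable
      (Filter.Eventually.of_forall fun r => ?_)
    simp only [Function.uncurry, norm_mul]
    calc _ ≤ B * 1 := mul_le_mul (h.abs_ext_le _ _) (Real.abs_cos_le_one _) (abs_nonneg _) h.nonneg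
      _ = B := mul_one B
  simp only [characteristicIntegral, ← intervalIntegral.integral_mul_const]
  rw [intervalIntegral_intervalIntegral_swap hi, ← intervalIntegral.integral_neg]
  congr 1
  ext s
  rw [integral_periodicExt_mul_cos continuous_zero (h.cont s) (h.zero s).1 (h.zero s).2]
  simp

end IsAdmissibleSource

/-! ### D'Alembert representation of strong solutions -/

lemma isBoundedL1_of_eLpNorm_le {p : ℝ} (hp : 1 ≤ p) {I : Set ℝ} {u : ℝ → ℝ → ℝ} {M : ℝ≥0}
    (hm : JointlyMeasurable I u)
    (h : ∀ᵐ t ∂(volume.restrict I), MemLp (u t) (ENNReal.ofReal p) spaceMeasure ∧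
      eLpNorm (u t) (ENNReal.ofReal p) spaceMeasure ≤ M) : IsBoundedL1 I u M where
  meas := hm
  bound := by
    filter_upwards [h] with t ht
    refine ⟨ht.1.integrable_spaceMeasure hp,
      integral_norm_le_of_eLpNorm_le hp ht.1.1 M.coe_nonneg ?_⟩
    rw [ENNReal.ofReal_coe_nnreal]
    exact ht.2

lemma MemLinftyW1Zero.exists_isBoundedL1 {p : ℝ} (hp : 1 ≤ p) {I : Set ℝ} {u ux : ℝ → ℝ → ℝ}
    (h : MemLinftyW1Zero p I u ux) : ∃ M : ℝ≥0, IsBoundedL1 I u M ∧ IsBoundedL1 I ux M := by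
  obtain ⟨M, hM⟩ := h.bounded
  refine ⟨M, isBoundedL1_of_eLpNorm_le hp h.meas ?_, isBoundedL1_of_eLpNorm_le hp h.meas_x ?_⟩
  · filter_upwards [hM, h.mem] with t h1 h2
    exact ⟨h2.memLp, (le_add_right le_rfl).trans h1⟩
  · filter_upwards [hM, h.mem] with t h1 h2
    exact ⟨h2.memLp_deriv, (le_add_left le_rfl).trans h1⟩

lemma MemLinftyW2Zero.exists_isBoundedL1 {p : ℝ} (hp : 1 ≤ p) {I : Set ℝ} {u ux uxx : ℝ → ℝ → ℝ}
    (h : MemLinftyW2Zero p I u ux uxx) : ∃ M : ℝ≥0, IsBoundedL1 I u M ∧ IsBoundedL1 I uxx M := by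
  obtain ⟨M, hM⟩ := h.bounded
  refine ⟨M, isBoundedL1_of_eLpNorm_le hp h.meas ?_, isBoundedL1_of_eLpNorm_le hp h.meas_xx ?_⟩
  · filter_upwards [hM, h.mem] with t h1 h2
    exact ⟨h2.zero_trace.memLp, (le_add_right (le_add_right le_rfl)).trans h1⟩
  · filter_upwards [hM, h.mem] with t h1 h2
    exact ⟨h2.second.memLp_deriv, (le_add_left le_rfl).trans h1⟩

/-- A time dependent continuous periodic function with constant Fourier coefficients is constant in
time. -/
lemma exists_profile_of_const_coeff {μ : Measure ℝ} [NeZero μ] {E : ℝ → ℝ → ℝ}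
    (hE : ∀ᵐ t ∂μ, Continuous (E t) ∧ Function.Periodic (E t) 2)
    (h : ∀ (k : ℤ) (m : ℕ), ∃ C : ℝ, ∀ᵐ t ∂μ,
      ∫ y in (-1 : ℝ)..1, E t y * Real.cos (k * Real.pi * y + m * (Real.pi / 2)) = C) :
    ∃ A : ℝ → ℝ, Continuous A ∧ Function.Periodic A 2 ∧ ∀ᵐ t ∂μ, E t = A := by
  choose C hC using h
  have hC' := ae_all_iff.2 fun k => ae_all_iff.2 (hC k)
  obtain ⟨t₀, h₀, h₀'⟩ := (hE.and hC').exists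
  refine ⟨E t₀, h₀.1, h₀.2, ?_⟩
  filter_upwards [hE, hC'] with t ht ht'
  ext y
  have hp : Function.Periodic (fun y => E t y - E t₀ y) 2 := fun y => by
    simp only [ht.2 y, h₀.2 y]
  have hcoef : ∀ (k : ℤ) (m : ℕ), ∫ y in (-1 : ℝ)..1,
      (E t y - E t₀ y) * Real.cos (k * Real.pi * y + m * (Real.pi / 2)) = 0 := fun k m => by
    have hcos : Continuous fun y => Real.cos (k * Real.pi * y + m * (Real.pi / 2)) := by fun_prop
    have i1 : IntervalIntegrable (fun y => E t y * Real.cos (k * Real.pi * y + m * (Real.pi / 2)))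
        volume (-1) 1 := (ht.1.mul hcos).intervalIntegrable _ _
    have i2 : IntervalIntegrable (fun y => E t₀ y * Real.cos (k * Real.pi * y + m * (Real.pi / 2)))
        volume (-1) 1 := (h₀.1.mul hcos).intervalIntegrable _ _
    simp only [sub_mul]
    rw [intervalIntegral.integral_sub i1 i2, ht' k m, h₀' k m, sub_self]
  exact sub_eq_zero.1 (hp.eq_zero_of_integral_mul_cos_eq_zero (ht.1.sub h₀.1) hcoef y)

lemma restrict_interior_eq {I : Set ℝ} (hI : I.OrdConnected) :
    volume.restrict (interior I) = volume.restrict I :=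
  Measure.restrict_congr_set (interior_ae_eq_of_null_frontier (hI.convex.addHaar_frontier volume))

/-- Along the characteristics `y = x + t` the periodically extended Riemann invariant, corrected by
the accumulated source, is a fixed continuous periodic profile. -/
lemma IsStrongSolution.exists_profile {p : ℝ} (hp : 1 ≤ p) {a g : ℝ → ℝ}
    (ha : ContinuousOn a (Icc 0 1)) (hg : Continuous g) (hg0 : g 0 = 0) {I : Set ℝ}
    (hI : I.OrdConnected) (hn : I.Nontrivial) (hI0 : I ⊆ Ici 0) {z₀ z₁ : ℝ → ℝ}
    {z : ℝ → ℝ → ℝ} (hz : IsStrongSolution p a g I z₀ z₁ z) :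
    ∃ (v q : ℝ → ℝ → ℝ) (B : ℝ) (A : ℝ → ℝ), IsAdmissibleSource q B ∧
      (∀ t, ∀ x ∈ Icc (0 : ℝ) 1, q t x = a x * g (v t x)) ∧ (∀ t, v t 0 = 0 ∧ v t 1 = 0) ∧
      Continuous A ∧ Function.Periodic A 2 ∧
      ∀ᵐ t ∂(volume.restrict I), ∃ P : ℝ → ℝ, Continuous P ∧
        (∀ᵐ x ∂spaceMeasure, z t x = ∫ y in (0 : ℝ)..x, P y) ∧
        ∀ y, periodicExt P (v t) (y - t) + characteristicIntegral q t y = A y := by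
  obtain ⟨zx, zxx, zt, ztx, ztt, h2, h1, hzt, httm, hztt, heq⟩ := hz.equation
  obtain ⟨M₂, hz1, hzxx1⟩ := h2.exists_isBoundedL1 hp
  obtain ⟨M₁, hzt1, hztx1⟩ := h1.exists_isBoundedL1 hp
  obtain ⟨v, hvm, hvc, hv0, hvb, hve⟩ := exists_velocity_rep (w := zt) M₁.coe_nonneg hztx1 (by
    filter_upwards [h1.mem] with t ht
    exact ht.ae_eq_primitive hp)
  obtain ⟨Ba, hBa⟩ := isCompact_Icc.exists_bound_of_continuousOn ha
  obtain ⟨Bg, hBg⟩ := (isCompact_Icc (a := -(M₁ : ℝ)) (b := M₁)).exists_bound_of_continuousOn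
    hg.continuousOn
  have hat : Continuous fun x => a (triangleWave x) :=
    ha.comp_continuous continuous_triangleWave triangleWave_mem
  -- composing `a` with the triangle wave keeps its values on `[0,1]` and makes it continuous on `ℝ`
  set q : ℝ → ℝ → ℝ := fun t x => a (triangleWave x) * g (v t x) with hq
  have hqs : IsAdmissibleSource q (Ba * Bg) :=
    { meas := fun x => ((hg.comp_stronglyMeasurable (hvm x))).const_mul _
      cont := fun t => hat.mul (hg.comp (hvc t))
      zero := fun t => by simp [hq, (hv0 t).1, (hv0 t).2, hg0]
      bound := fun t x hx => by
        rw [hq, abs_mul]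
        refine mul_le_mul (hBa _ (triangleWave_mem x)) (hBg _ (abs_le.1 (hvb t x hx)))
          (abs_nonneg _) ((norm_nonneg _).trans (hBa _ (triangleWave_mem x))) }
  have hqi : ∀ t, Integrable (q t) spaceMeasure := fun t =>
    (integrable_spaceMeasure_iff _).2 ((hqs.cont t).intervalIntegrable _ _)
  have heq' : ∀ᵐ t ∂(volume.restrict I), ∀ᵐ x ∂spaceMeasure, ztt t x = zxx t x - q t x := by
    rw [restrict_prod_eq] at heq
    filter_upwards [Measure.ae_ae_of_ae_prod heq, hve] with t h3 h4
    filter_upwards [h3, h4, ae_mem_Ioo_spaceMeasure] with x h5 h6 hx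
    simp only [hq, triangleWave_of_mem (Ioo_subset_Icc_self hx), ← h6]
    linarith
  -- no integrability of `z_tt` is assumed; the equation provides it
  have hztt1 : IsBoundedL1 I ztt (M₂ + Ba * Bg) := by
    refine ⟨httm, ?_⟩
    filter_upwards [heq', hzxx1.bound] with t h3 h4
    have h5 : ztt t =ᵐ[spaceMeasure] fun x => zxx t x - q t x := h3
    refine ⟨(integrable_congr h5).2 (h4.1.sub (hqi t)), ?_⟩
    calc ∫ x, ‖ztt t x‖ ∂spaceMeasure ≤ ∫ x, (‖zxx t x‖ + Ba * Bg) ∂spaceMeasure := by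
          refine integral_mono_of_nonneg (Filter.Eventually.of_forall fun x => norm_nonneg _)
            (h4.1.norm.add (integrable_const _)) ?_
          filter_upwards [h5, ae_mem_Ioo_spaceMeasure] with x hx hx01
          simp only [hx]
          exact (norm_sub_le _ _).trans
            (add_le_add le_rfl (hqs.bound t x (Ioo_subset_Icc_self hx01)))
      _ ≤ M₂ + Ba * Bg := by
          rw [integral_add h4.1.norm (integrable_const _)]
          simp only [integral_const, probReal_univ, one_smul]
          linarith [h4.2]
  have hP : ∀ t, ∃ P : ℝ → ℝ, IsW2Zero p (z t) (zx t) (zxx t) → Continuous P ∧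
      (∀ᵐ x ∂spaceMeasure, z t x = ∫ y in (0 : ℝ)..x, P y) ∧ ∀ κ : ℝ, Real.sin κ = 0 →
        (∫ x in (0 : ℝ)..1, P x * Real.cos (κ * x) =
          κ * ∫ x, z t x * Real.sin (κ * x) ∂spaceMeasure)
        ∧ ∫ x, zxx t x * Real.sin (κ * x) ∂spaceMeasure =
          - κ ^ 2 * ∫ x, z t x * Real.sin (κ * x) ∂spaceMeasure := fun t => by
    by_cases ht : IsW2Zero p (z t) (zx t) (zxx t)
    · obtain ⟨P, hP⟩ := ht.exists_continuous_deriv hp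
      exact ⟨P, fun _ => hP⟩
    · exact ⟨0, fun h => absurd h ht⟩
  choose P hP using hP
  have hP' := h2.mem.mono fun t ht => hP t ht
  have : NeZero (volume.restrict I) := ⟨by
    rw [← restrict_interior_eq hI, Ne, Measure.restrict_eq_zero]
    exact (isOpen_interior.measure_pos volume (interior_nonempty_of_nontrivial hI hn)).ne'⟩
  obtain ⟨A, hA, hAp, hAe⟩ := exists_profile_of_const_coeff (μ := volume.restrict I)
    (E := fun t y => periodicExt (P t) (v t) (y - t) + characteristicIntegral q t y) (by
      filter_upwards [hP'] with t ht
      refine ⟨?_, fun y => ?_⟩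
      · exact ((continuous_periodicExt ht.1 (hvc t) (hv0 t).1 (hv0 t).2).comp
          (continuous_id.sub continuous_const)).add
          (hqs.continuous_characteristicIntegral.comp (Continuous.prodMk_right t))
      · simp only [IsAdmissibleSource.periodic_characteristicIntegral t y,
          ← periodicExt_periodic (P t) (v t) (y - t)]
        ring_nf) (by
    intro k m
    set κ : ℝ := k * Real.pi with hκ
    set θ : ℝ := m * (Real.pi / 2)
    have hsκ : Real.sin κ = 0 := Real.sin_int_mul_pi k
    have hψ : Continuous fun x => Real.sin (κ * x) := by fun_prop
    have hψ1 : ∀ x, |Real.sin (κ * x)| ≤ 1 := fun x => Real.abs_sin_le_one _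
    obtain ⟨C, hC⟩ := exists_const_of_weak_oscillator (J := interior I) isOpen_interior
      hI.interior (interior_subset.trans hI0)
      (c := fun t => ∫ x, z t x * Real.sin (κ * x) ∂spaceMeasure)
      (d := fun t => ∫ x, zt t x * Real.sin (κ * x) ∂spaceMeasure)
      (e := fun t => ∫ x, ztt t x * Real.sin (κ * x) ∂spaceMeasure)
      (f := fun t => ∫ x in (0 : ℝ)..1, q t x * Real.sin (κ * x))
      ((hz1.locallyIntegrableOn_coeff hψ hψ1).mono_set interior_subset)
      ((hzt1.locallyIntegrableOn_coeff hψ hψ1).mono_set interior_subset)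
      (hqs.measurable_coeff κ).1 (hqs.measurable_coeff κ).2 κ θ
      (fun φ hφ => by
        rw [restrict_interior_eq hI]
        exact hz1.integral_deriv_mul_coeff hzt1 hzt hφ hψ hψ1)
      (fun φ hφ => by
        rw [restrict_interior_eq hI]
        exact hzt1.integral_deriv_mul_coeff hztt1 hztt hφ hψ hψ1)
      (by
        rw [restrict_interior_eq hI]
        filter_upwards [heq', hzxx1.bound, hP'] with t h3 h4 h5
        rw [← (h5.2.2 κ hsκ).2, ← integral_spaceMeasure, ← integral_sub
          (h4.1.mul_bdd (c := 1) hψ.aestronglyMeasurable (Filter.Eventually.of_forall hψ1))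
          ((hqi t).mul_bdd (c := 1) hψ.aestronglyMeasurable (Filter.Eventually.of_forall hψ1))]
        refine integral_congr_ae ?_
        filter_upwards [h3] with x hx
        rw [hx]; ring)
    rw [restrict_interior_eq hI] at hC
    refine ⟨C, ?_⟩
    filter_upwards [hC, hP', hve] with t h3 h4 h5
    have hcos : Continuous fun y => Real.cos (κ * y + θ) := by fun_prop
    have c1 : Continuous fun y => periodicExt (P t) (v t) (y - t) :=
      (continuous_periodicExt h4.1 (hvc t) (hv0 t).1 (hv0 t).2).comp
        (continuous_id.sub continuous_const)
    have c2 : Continuous (characteristicIntegral q t) :=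
      hqs.continuous_characteristicIntegral.comp (Continuous.prodMk_right t)
    have hd : ∫ x in (0 : ℝ)..1, v t x * Real.sin (κ * x) =
        ∫ x, zt t x * Real.sin (κ * x) ∂spaceMeasure := by
      rw [← integral_spaceMeasure]
      refine integral_congr_ae ?_
      filter_upwards [h5] with x hx
      rw [hx]
    have i1 : IntervalIntegrable (fun y => periodicExt (P t) (v t) (y - t) * Real.cos (κ * y + θ))
        volume (-1) 1 := (c1.mul hcos).intervalIntegrable _ _
    have i2 : IntervalIntegrable (fun y => characteristicIntegral q t y * Real.cos (κ * y + θ))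
        volume (-1) 1 := (c2.mul hcos).intervalIntegrable _ _
    simp only [add_mul]
    rw [intervalIntegral.integral_add i1 i2,
      integral_periodicExt_mul_cos h4.1 (hvc t) (hv0 t).1 (hv0 t).2,
      hqs.integral_characteristicIntegral_mul_cos, ← hκ, (h4.2.2 κ hsκ).1, hd]
    linear_combination h3)
  refine ⟨v, q, Ba * Bg, A, hqs, fun t x hx => by simp only [hq, triangleWave_of_mem hx], hv0, hA,
    hAp, ?_⟩
  filter_upwards [hAe, hP'] with t h3 h4
  exact ⟨P t, h4.1, h4.2.1, fun y => congrFun h3 y⟩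

/-! ### Continuity of the source and the energy identities -/

lemma Set.OrdConnected.subset_closure_interior {J : Set ℝ} (hJ : J.OrdConnected)
    (hn : J.Nontrivial) : J ⊆ closure (interior J) := by
  rw [(hJ.convex (𝕜 := ℝ)).closure_interior_eq_closure_of_nonempty_interior
    (interior_nonempty_of_nontrivial hJ hn)]
  exact subset_closure

lemma continuous_dAlembert {H : ℝ → ℝ → ℝ} (hHc : Continuous H.uncurry) :
    Continuous fun r : ℝ × ℝ => (∫ y in (r.1 - r.2)..(r.1 + r.2), H r.1 y) / 2 := by
  have h1 := intervalIntegral.continuous_parametric_intervalIntegral_of_continuous (μ := volume)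
    (a₀ := 0) (f := fun (r : ℝ × ℝ) y => H r.1 y)
    (hHc.comp ((continuous_fst.comp continuous_fst).prodMk continuous_snd))
    (s := fun r => r.1 + r.2) (continuous_fst.add continuous_snd)
  have h2 := intervalIntegral.continuous_parametric_intervalIntegral_of_continuous (μ := volume)
    (a₀ := 0) (f := fun (r : ℝ × ℝ) y => H r.1 y)
    (hHc.comp ((continuous_fst.comp continuous_fst).prodMk continuous_snd))
    (s := fun r => r.1 - r.2) (continuous_fst.sub continuous_snd)
  refine ((h1.sub h2).div_const 2).congr fun r => ?_
  have hc : Continuous (H r.1) := hHc.comp (Continuous.prodMk_right r.1)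
  simp only [Pi.sub_apply]
  rw [intervalIntegral.integral_interval_sub_left (hc.intervalIntegrable _ _)
    (hc.intervalIntegrable _ _)]

/-- The D'Alembert formula for `z` at every time and point, from its differentiated form at almost
every time: both sides are continuous on `I × [0,1]`. -/
lemma eq_dAlembert_of_ae {I : Set ℝ} (hI : I.OrdConnected) (hn : I.Nontrivial)
    {z H : ℝ → ℝ → ℝ} (hz : ContinuousOn (fun q : ℝ × ℝ => z q.1 q.2) (I ×ˢ Icc (0 : ℝ) 1))
    (hHc : Continuous H.uncurry)
    (hae : ∀ᵐ t ∂(volume.restrict I), ∃ P : ℝ → ℝ,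
      (∀ᵐ x ∂spaceMeasure, z t x = ∫ y in (0 : ℝ)..x, P y) ∧
      EqOn P (fun y => (H t (t + y) + H t (t - y)) / 2) (Ioo 0 1)) {t : ℝ} (ht : t ∈ I) {x : ℝ}
    (hx : x ∈ Icc (0 : ℝ) 1) : z t x = (∫ y in (t - x)..(t + x), H t y) / 2 := by
  have hint := continuous_dAlembert hHc
  have hz1 : ∀ᵐ t ∂(volume.restrict I), ∀ x ∈ Icc (0 : ℝ) 1,
      z t x = (∫ y in (t - x)..(t + x), H t y) / 2 := by
    filter_upwards [hae, ae_restrict_mem hI.measurableSet] with t ht htI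
    obtain ⟨P, hzP, hPH⟩ := ht
    have hc : Continuous (H t) := hHc.comp (Continuous.prodMk_right t)
    refine Measure.eqOn_of_ae_eq (μ := volume) (s := Icc (0 : ℝ) 1) ?_ ?_ ?_
      (ordConnected_Icc.subset_closure_interior ⟨0, by simp, 1, by simp, zero_ne_one⟩)
    · rw [Measure.restrict_congr_set Ioo_ae_eq_Icc.symm]
      change ∀ᵐ x ∂spaceMeasure, _
      filter_upwards [hzP, ae_mem_Ioo_spaceMeasure] with x hx hx01
      rw [hx]
      have e1 : ∫ y in (0 : ℝ)..x, P y = ∫ y in (0 : ℝ)..x, (H t (t + y) + H t (t - y)) / 2 := by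
        refine intervalIntegral.integral_congr_ae (Filter.Eventually.of_forall fun y hy => ?_)
        rw [uIoc_of_le hx01.1.le] at hy
        exact hPH ⟨hy.1, hy.2.trans_lt hx01.2⟩
      have c1 : Continuous fun y => H t (t + y) := by fun_prop
      have c2 : Continuous fun y => H t (t - y) := by fun_prop
      rw [e1, intervalIntegral.integral_div, intervalIntegral.integral_add
        (c1.intervalIntegrable _ _) (c2.intervalIntegrable _ _),
        intervalIntegral.integral_comp_add_left (fun y => H t y),
        intervalIntegral.integral_comp_sub_left (fun y => H t y), add_zero, sub_zero, add_comm,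
        intervalIntegral.integral_add_adjacent_intervals (hc.intervalIntegrable _ _)
          (hc.intervalIntegrable _ _)]
    · exact hz.comp (Continuous.prodMk_right t).continuousOn
        fun x hx => mk_mem_prod htI hx
    · exact (hint.comp (Continuous.prodMk_right t)).continuousOn
  refine Measure.eqOn_of_ae_eq (μ := volume) (s := I) (f := fun t => z t x)
    (g := fun t => (∫ y in (t - x)..(t + x), H t y) / 2) ?_ ?_ ?_ (hI.subset_closure_interior hn) ht
  · filter_upwards [hz1] with s hs
    exact hs x hx
  · exact hz.comp (Continuous.prodMk_left x).continuousOn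
      fun s hs => mk_mem_prod hs hx
  · exact (hint.comp (Continuous.prodMk_left x)).continuousOn

/-- The source known only to be measurable in time may be replaced by a jointly continuous one. -/
lemma exists_continuous_source {a g : ℝ → ℝ} (ha : ContinuousOn a (Icc 0 1)) (hg : Continuous g)
    (hg0 : g 0 = 0) {I : Set ℝ} (hI : I.OrdConnected) (hI0 : I ⊆ Ici 0) (hI1 : (0 : ℝ) ∈ I)
    {v q : ℝ → ℝ → ℝ} {B : ℝ} {A : ℝ → ℝ} (hq : IsAdmissibleSource q B)
    (hqv : ∀ t, ∀ x ∈ Icc (0 : ℝ) 1, q t x = a x * g (v t x)) (hv0 : ∀ t, v t 0 = 0 ∧ v t 1 = 0)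
    (hA : Continuous A) (hAp : Function.Periodic A 2)
    (hae : ∀ᵐ t ∂(volume.restrict I), ∃ P : ℝ → ℝ,
      ∀ y, periodicExt P (v t) (y - t) + characteristicIntegral q t y = A y) :
    ∃ H G : ℝ → ℝ → ℝ, (∀ t ∈ I, ∀ y, H t y = A y - characteristicIntegral q t y) ∧
      Continuous H.uncurry ∧ Continuous G.uncurry ∧ (∀ t, Function.Periodic (H t) 2) ∧
      (∀ t x, G t (-x) = - G t x) ∧
      (∀ t y, HasDerivAt (fun s => H s y) (- G t (y - t)) t) ∧
      ∀ t ∈ I, ∀ x ∈ Icc (0 : ℝ) 1, G t x = a x * g ((H t (t + x) - H t (t - x)) / 2) := by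
  have hVc := hq.continuous_characteristicIntegral
  -- the Riemann invariants expressed through the source known only to be measurable in time
  set R : ℝ → ℝ → ℝ := fun t y => A y - characteristicIntegral q t y with hR
  have hRc : Continuous R.uncurry := (hA.comp continuous_snd).sub hVc
  have hRp : ∀ t, Function.Periodic (R t) 2 := fun t y => by
    simp only [hR, hAp y, IsAdmissibleSource.periodic_characteristicIntegral t y]
  have hR0 : ∀ t, ∀ x, x = 0 ∨ x = 1 → R t (t + x) - R t (t - x) = 0 := by
    rintro t x (rfl | rfl)
    · simp
    · rw [← hRp t (t - 1)]; ring_nf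
  obtain ⟨G, hG⟩ : ∃ G : ℝ → ℝ → ℝ, G = fun t x => squareWave x * (a (triangleWave x) *
    g ((R t (t + triangleWave x) - R t (t - triangleWave x)) / 2)) := ⟨_, rfl⟩
  have hG01 : ∀ t, ∀ x ∈ Icc (0 : ℝ) 1, G t x = a x * g ((R t (t + x) - R t (t - x)) / 2) := by
    intro t x hx
    simp only [hG, triangleWave_of_mem hx]
    by_cases hx' : x ∈ Ioo (0 : ℝ) 1
    · rw [squareWave_of_mem hx', one_mul]
    · have : x = 0 ∨ x = 1 := by
        rcases hx.1.eq_or_lt with h | h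
        · exact Or.inl h.symm
        · exact Or.inr (le_antisymm hx.2 (not_lt.1 fun h' => hx' ⟨h, h'⟩))
      simp [hR0 t x this, hg0]
  have hGc : Continuous G.uncurry := by
    rw [hG]
    refine continuous_squareWave_mul continuous_snd ?_ fun r hr => ?_
    · have ht : Continuous fun r : ℝ × ℝ => triangleWave r.2 :=
        continuous_triangleWave.comp continuous_snd
      refine ((ha.comp_continuous continuous_triangleWave triangleWave_mem).comp
        continuous_snd).mul (hg.comp (Continuous.div_const (Continuous.sub ?_ ?_) 2))
      · exact hRc.comp (continuous_fst.prodMk (continuous_fst.add ht))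
      · exact hRc.comp (continuous_fst.prodMk (continuous_fst.sub ht))
    · simp only [hR0 r.1 _ hr, zero_div, hg0, mul_zero]
  have hGp : ∀ t, Function.Periodic (G t) 2 := fun t x => by
    simp only [hG, triangleWave_add_two, squareWave_add_two]
  have hGy : ∀ y, Continuous fun s => G s (y - s) := fun y =>
    hGc.comp (continuous_id.prodMk (continuous_const.sub continuous_id))
  -- at almost every time the measurable source is the continuous one
  have hqG : ∀ᵐ s ∂(volume.restrict I), ∀ x, periodicExt 0 (q s) x = G s x := by
    filter_upwards [hae] with s hs x
    obtain ⟨P, hPA⟩ := hs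
    simp only [periodicExt, Pi.zero_apply, zero_add, hG, hqv s _ (triangleWave_mem x)]
    have hmem := triangleWave_mem x
    generalize triangleWave x = e at hmem ⊢
    suffices hve : v s e = (R s (s + e) - R s (s - e)) / 2 by rw [hve]
    by_cases he : e ∈ Ioo (0 : ℝ) 1
    · have h1 := hPA (s + e)
      have h2 := hPA (s - e)
      rw [add_sub_cancel_left, periodicExt_of_mem _ _ he] at h1
      rw [show s - e - s = -e by ring, periodicExt_neg_of_mem _ _ he] at h2
      simp only [hR]
      linarith
    · have : e = 0 ∨ e = 1 := by
        rcases hmem.1.eq_or_lt with h | h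
        · exact Or.inl h.symm
        · exact Or.inr (le_antisymm hmem.2 (not_lt.1 fun h' => he ⟨h, h'⟩))
      rw [hR0 s e this, zero_div]
      rcases this with rfl | rfl
      exacts [(hv0 s).1, (hv0 s).2]
  have hVG : ∀ t ∈ I, ∀ y, characteristicIntegral q t y = ∫ s in (0 : ℝ)..t, G s (y - s) := by
    intro t ht y
    refine intervalIntegral.integral_congr_ae_restrict ?_
    have hsub : uIoc 0 t ⊆ I := by
      rw [uIoc_of_le (hI0 ht)]
      exact Ioc_subset_Icc_self.trans (hI.out hI1 ht)
    refine ae_restrict_of_ae_restrict_of_subset hsub ?_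
    filter_upwards [hqG] with s hs
    exact hs _
  set H : ℝ → ℝ → ℝ := fun t y => A y - ∫ s in (0 : ℝ)..t, G s (y - s) with hH
  have hHR : ∀ t ∈ I, H t = R t := fun t ht => by
    ext y
    simp only [hH, hR, hVG t ht y]
  have hHc : Continuous H.uncurry := by
    refine (hA.comp continuous_snd).sub ?_
    exact intervalIntegral.continuous_parametric_intervalIntegral_of_continuous
      (f := fun (r : ℝ × ℝ) s => G s (r.2 - s))
      (hGc.comp (continuous_snd.prodMk ((continuous_snd.comp continuous_fst).sub continuous_snd)))
      continuous_fst
  refine ⟨H, G, fun t ht y => congrFun (hHR t ht) y, hHc, hGc, fun t y => ?_, fun t x => ?_,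
    fun t y => ?_, fun t ht x hx => ?_⟩
  · have : ∀ s, G s (y + 2 - s) = G s (y - s) := fun s => by
      rw [← hGp s (y - s)]; ring_nf
    simp only [hH, hAp y, this]
  · simp only [hG, triangleWave_neg, squareWave_neg, neg_mul]
  · exact (intervalIntegral.integral_hasDerivAt_right ((hGy y).intervalIntegrable _ _)
      ((hGy y).stronglyMeasurableAtFilter _ _) (hGy y).continuousAt).const_sub (A y)
  · rw [hHR t ht, hG01 t x hx]

/-- Strong solutions have a D'Alembert representation with a continuous damping term. -/
theorem IsStrongSolution.exists_isCharacteristicRep {p : ℝ} (hp : 1 ≤ p) {a g : ℝ → ℝ}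
    (ha : ContinuousOn a (Icc 0 1)) (hg : Continuous g) (hg0 : g 0 = 0) {I : Set ℝ}
    (hI : I.OrdConnected) (hn : I.Nontrivial) (hI0 : I ⊆ Ici 0) (hI1 : (0 : ℝ) ∈ I)
    {z₀ z₁ : ℝ → ℝ} {z : ℝ → ℝ → ℝ} (hz : IsStrongSolution p a g I z₀ z₁ z) :
    ∃ H G : ℝ → ℝ → ℝ, IsCharacteristicRep a g I z H G := by
  obtain ⟨v, q, B, A, hq, hqv, hv0, hA, hAp, hae⟩ := hz.exists_profile hp ha hg hg0 hI hn hI0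
  obtain ⟨H, G, hHA, hHc, hGc, hHp, hGo, hHd, hGs⟩ := exists_continuous_source ha hg hg0 hI hI0 hI1
    hq hqv hv0 hA hAp (hae.mono fun t ht => ht.imp fun P hP => hP.2.2)
  refine ⟨H, G, hHc, hGc, hHp, hGo, hHd, hGs, fun t ht x hx =>
    eq_dAlembert_of_ae hI hn hz.continuousOn hHc ?_ ht hx⟩
  filter_upwards [hae, ae_restrict_mem hI.measurableSet] with t ht htI
  obtain ⟨P, -, hzP, hPA⟩ := ht
  refine ⟨P, hzP, fun y hy => ?_⟩
  have h1 := hPA (t + y)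
  have h2 := hPA (t - y)
  rw [add_sub_cancel_left, periodicExt_of_mem _ _ hy] at h1
  rw [show t - y - t = -y by ring, periodicExt_neg_of_mem _ _ hy] at h2
  simp only [hHA t htI]
  linarith

theorem mainTheorem8
    (p : ℝ) (hp : 1 ≤ p)
    (a g : ℝ → ℝ)
    (ha_cont : ContinuousOn a (Icc 0 1)) (ha_nonneg : ∀ x ∈ Icc (0 : ℝ) 1, 0 ≤ a x)
    (hg_smooth : ContDiff ℝ 1 g) (hg_mono : Monotone g) (hg_zero : g 0 = 0)
    (I : Set ℝ) (hI : I.OrdConnected) (hI_nontrivial : I.Nontrivial)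
    (hI_nonneg : I ⊆ Ici 0) (hI_zero : (0 : ℝ) ∈ I)
    (z₀ z₁ : ℝ → ℝ) (z : ℝ → ℝ → ℝ)
    (hz : IsStrongSolution p a g I z₀ z₁ z) :
    -- the classical derivatives in `ρ` and `ξ` exist
    (∀ t ∈ I, ∀ x ∈ Ioo (0 : ℝ) 1,
      DifferentiableAt ℝ (z t) x ∧ DifferentiableWithinAt ℝ (fun s => z s x) I t) ∧
    (∀ F : ℝ → ℝ, ContDiff ℝ 1 F → ConvexOn ℝ univ F →
      (∀ t ∈ I,
        IntegrableOn (fun x => F (riemannRho I z t x)) (Ioo 0 1) ∧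
        IntegrableOn (fun x => F (riemannXi I z t x)) (Ioo 0 1) ∧
        IntegrableOn (dissipation F a g I z t) (Ioo 0 1) ∧
        HasDerivWithinAt (convexFunctional F I z)
          (- ∫ x in Ioo (0 : ℝ) 1, dissipation F a g I z t x) I t) ∧
      AntitoneOn (convexFunctional F I z) I) ∧
    (∀ t ∈ I,
      IntegrableOn (fun x => |riemannRho I z t x| ^ p) (Ioo 0 1) ∧
      IntegrableOn (fun x => |riemannXi I z t x| ^ p) (Ioo 0 1)) ∧
    AntitoneOn (pEnergy p I z) I := by
  obtain ⟨H, G, h⟩ := hz.exists_isCharacteristicRep hp ha_cont hg_smooth.continuous hg_zero hI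
    hI_nontrivial hI_nonneg hI_zero
  refine ⟨fun t ht x hx => ⟨(h.hasDerivAt_space ht hx).differentiableAt,
    (h.hasDerivWithinAt_time ht hx).differentiableWithinAt⟩, fun F hF hFc => ⟨fun t ht => ?_,
    h.antitoneOn_convexFunctional ha_nonneg hg_mono hg_zero hI hI_nontrivial hF hFc⟩,
    fun t ht => ?_,
    h.antitoneOn_pEnergy ha_nonneg hg_mono hg_zero hI hI_nontrivial hp⟩
  · have hi := h.integrableOn_comp hI hI_nontrivial hF.continuous ht
    exact ⟨hi.1, hi.2, h.integrableOn_dissipation hI hI_nontrivial hF ht,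
      h.hasDerivWithinAt_convexFunctional hI hI_nontrivial hF ht⟩
  · exact h.integrableOn_comp hI hI_nontrivial (F := fun r => |r| ^ p)
      (continuous_abs.rpow_const fun _ => Or.inr (by linarith)) ht
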